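/- All graphs are finite and simple. A drawing of a graph maps vertices to distinct points of the plane and each edge to a simple arc joining its ends and containing no other vertex point, such that no three edges meet in a common point that is not a vertex point; a crossing is a common point of two distinct edges that is not a vertex point. The crossing number $\mathrm{cr}(\cdot)$ is the minimum number of crossings over all drawings. A drawing is good if edges with a common end do not cross and no two edges meet more than once. Let $P_n$ be the path with $n$ edges. In the Cartesian product $G\Box P_n$ let $G^0,\dots,G^n$ be the copies of $G$, and let $H^i$ ($0\le i\le n-1$) be the set of edges linking $G^i$ to $G^{i+1}$; $G^i$ and $H^i$ are empty for all other integers $i$. For sets of edges $X,Y$ write $X\otimes Y$ for the set of pairs consisting of an edge of $X$ and an edge of $Y$, where pairs are regarded as unordered. For $0\le i\le n$ define the crossing band $$A^n_i=\bigcup_{j=0}^{2i}\Big((G^j\cup H^j)\otimes(G^{2i-j-1}\cup H^{2i-j-1}\cup G^{2i-j})\Big)\cup\Big(H^j\otimes H^{2i-j-2}\Big).$$ A crossing is from a set of pairs if its pair of edges belongs to that set. For a positive integer $a$, a good drawing of $G\Box P_n$ is $a$-restricted if, for each $i$, fewer than $a$ of its crossings involve an edge of $G^i$. Fix integers $a\ge1$,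 $b$, $d\ge2$, $0<m<d$ and $0\le k\le d-m+1$. All minima below are over $a$-restricted good drawings of $G\Box P_d$ (subject to the stated extra constraints), with $\min\emptyset=+\infty$: * $F,M,E$ (front, middle, end force) are the minimum numbers of crossings from $A^d_0\cup\dots\cup A^d_{m-1}$, from $A^d_m$, and from $A^d_{m+1}\cup\dots\cup A^d_d$, respectively. * $F^+$ is defined as $F$, but only over drawings having, for every $r\in\{0,\dots,k-1\}$, at most $(r+1)a$ crossings from $A^d_m\cup\dots\cup A^d_{m+r}$. * $M^+$ is defined as $M$, but only over drawings having at most $a$ crossings from $A^d_{m+1}$. * $E^+$ is defined as $E$, but only over drawings having at most $a-1$ crossings from $A^d_m$. The star-forces are $F^*=\min\{F^+,F+1\}$, $M^*=\min\{M^+,M+1\}$, $E^*=\min\{E^+-1,E\}$. **Theorem.** Let $k'=\max(k,1)$. If $$\mathrm{cr}(G\Box P_{d+k'-2})\ge a(d+k'-2)-b,\qquad F^*+E^*\ge a(d-1)-b,\qquad M^*\ge a,$$ then $\mathrm{cr}(G\Box P_n)\ge an-b$ for all $n\ge d+k'-1$. -/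

import Mathlib

/-- The Euclidean plane. -/
abbrev Plane : Type := EuclideanSpace ℝ (Fin 2)

/-- `A` is a simple (Jordan) arc in the plane joining `p` and `q`. -/
def IsArcBetween (p q : Plane) (A : Set Plane) : Prop :=
  ∃ γ : Path p q, Function.Injective γ ∧ Set.range γ = A

/-- A drawing of a graph in the plane: vertices are distinct points, every edge is a simple arc
joining the points of its two ends and containing no other vertex point, and no three edges meet
in a point that is not a vertex point. (The value of `curve` off the edge set is irrelevant.) -/
structure Drawing {W : Type*} (G : SimpleGraph W) where
  pt : W → Plane
  pt_injective : Function.Injective pt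
  curve : Sym2 W → Set Plane
  curve_arc : ∀ u v : W, G.Adj u v → IsArcBetween (pt u) (pt v) (curve s(u, v))
  curve_avoids : ∀ e ∈ G.edgeSet, ∀ w : W, pt w ∈ curve e → w ∈ e
  no_triple : ∀ e ∈ G.edgeSet, ∀ f ∈ G.edgeSet, ∀ g ∈ G.edgeSet, e ≠ f → e ≠ g → f ≠ g →
    ∀ p : Plane, p ∈ curve e → p ∈ curve f → p ∈ curve g → p ∈ Set.range pt

namespace Drawing

variable {W : Type*} {G : SimpleGraph W}

/-- All crossings of the drawing, with multiplicity: an unordered pair of distinct edges together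
with a point, not a vertex point, that lies on both of their curves. -/
def crossingPoints (D : Drawing G) : Set (Sym2 (Sym2 W) × Plane) :=
  {x | ∃ e ∈ G.edgeSet, ∃ f ∈ G.edgeSet, e ≠ f ∧ x.1 = s(e, f) ∧
    x.2 ∈ D.curve e ∧ x.2 ∈ D.curve f ∧ x.2 ∉ Set.range D.pt}

/-- The number of crossings of the drawing (possibly infinite). -/
noncomputable def numCrossings (D : Drawing G) : ℕ∞ := D.crossingPoints.encard

/-- The set of unordered pairs of edges that cross in the drawing. -/
def crossings (D : Drawing G) : Set (Sym2 (Sym2 W)) :=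
  {c | ∃ p : Plane, (c, p) ∈ D.crossingPoints}

/-- A drawing is good if two distinct edges with a common end meet only in that end, and no two
distinct edges meet more than once. -/
def IsGood (D : Drawing G) : Prop :=
  (∀ e ∈ G.edgeSet, ∀ f ∈ G.edgeSet, e ≠ f → ∀ w : W, w ∈ e → w ∈ f →
    D.curve e ∩ D.curve f ⊆ {D.pt w}) ∧
  (∀ e ∈ G.edgeSet, ∀ f ∈ G.edgeSet, e ≠ f → (D.curve e ∩ D.curve f).Subsingleton)

end Drawing

/-- The crossing number: the minimum of the number of crossings over all drawings. -/
noncomputable def crossingNumber {W : Type*} (G : SimpleGraph W) : ℕ∞ :=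
  ⨅ D : Drawing G, D.numCrossings

/-- Binary-weighted capacity-constrained crossing number: the minimum number of crossings from `B`
over all good drawings that, for each `(R, c)` in `cap`, have at most `c` crossings from `R`.
It is `⊤` if there is no such drawing. -/
noncomputable def bccnp {W : Type*} (G : SimpleGraph W) (B : Set (Sym2 (Sym2 W)))
    (cap : Set (Set (Sym2 (Sym2 W)) × ℕ)) : ℕ∞ :=
  ⨅ D : {D : Drawing G // D.IsGood ∧ ∀ R ∈ cap, (D.crossings ∩ R.1).encard ≤ (R.2 : ℕ∞)},
    (D.1.crossings ∩ B).encard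

namespace CartPath

variable {V : Type*}

/-- The Cartesian product of `G` with the path `P_n` with `n` edges (`n + 1` vertices). -/
abbrev prod (G : SimpleGraph V) (n : ℕ) : SimpleGraph (V × Fin (n + 1)) :=
  G □ SimpleGraph.pathGraph (n + 1)

/-- The edges of the `j`-th copy `G^j` of `G` in `G □ P_n` (empty unless `0 ≤ j ≤ n`). -/
def copyEdges (G : SimpleGraph V) (n : ℕ) (j : ℤ) : Set (Sym2 (V × Fin (n + 1))) :=
  {e | ∃ u v : V, G.Adj u v ∧ ∃ t : Fin (n + 1), (t.val : ℤ) = j ∧ e = s((u, t), (v, t))}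

/-- The path edges `H^j` between `G^j` and `G^(j+1)` (empty unless `0 ≤ j ≤ n - 1`). -/
def linkEdges (V : Type*) (n : ℕ) (j : ℤ) : Set (Sym2 (V × Fin (n + 1))) :=
  {e | ∃ v : V, ∃ t t' : Fin (n + 1), (t.val : ℤ) = j ∧ (t'.val : ℤ) = j + 1 ∧
    e = s((v, t), (v, t'))}

/-- The set of unordered pairs of an element of `E` and an element of `F`. -/
def crossPairs {W : Type*} (E F : Set (Sym2 W)) : Set (Sym2 (Sym2 W)) :=
  {c | ∃ e ∈ E, ∃ f ∈ F, c = s(e, f)}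

/-- The crossing band `A^n_i` of `G □ P_n`. -/
def band (G : SimpleGraph V) (n i : ℕ) : Set (Sym2 (Sym2 (V × Fin (n + 1)))) :=
  ⋃ j ∈ Set.Icc (0 : ℤ) (2 * i),
    crossPairs (copyEdges G n j ∪ linkEdges V n j)
        (copyEdges G n (2 * i - j - 1) ∪ linkEdges V n (2 * i - j - 1) ∪ copyEdges G n (2 * i - j))
      ∪ crossPairs (linkEdges V n j) (linkEdges V n (2 * i - j - 2))

/-- The union of the crossing bands `A^n_i` with `i ∈ I`. -/
def bands (G : SimpleGraph V) (n : ℕ) (I : Set ℕ) : Set (Sym2 (Sym2 (V × Fin (n + 1)))) :=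
  ⋃ i ∈ I, band G n i

/-- The capacity constraints that make a good drawing of `G □ P_n` `a`-restricted (`a ≥ 1`): each
copy `G^i` has at most `a - 1` crossings on its edges. -/
def restrictedCap (G : SimpleGraph V) (a n : ℕ) :
    Set (Set (Sym2 (Sym2 (V × Fin (n + 1)))) × ℕ) :=
  {R | ∃ i : Fin (n + 1),
    R = (crossPairs (copyEdges G n i.val) (prod G n).edgeSet, a - 1)}

/-- The minimum number of crossings from `B` over all `a`-restricted good drawings of `G □ P_d`
that also satisfy the capacity constraints `cap`. -/
noncomputable def restrictedMin (G : SimpleGraph V) (a d : ℕ)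
    (B : Set (Sym2 (Sym2 (V × Fin (d + 1)))))
    (cap : Set (Set (Sym2 (Sym2 (V × Fin (d + 1)))) × ℕ)) : ℕ∞ :=
  bccnp (prod G d) B (restrictedCap G a d ∪ cap)

/-- The embedding of `ℕ ∪ {∞}` into `ℤ ∪ {∞}`. -/
def toExtInt (x : ℕ∞) : WithTop ℤ := ENat.map (fun n : ℕ => (n : ℤ)) x

/-- Front force: crossings from `A^d_0, …, A^d_(m-1)`. -/
noncomputable def frontForce (G : SimpleGraph V) (a d m : ℕ) : ℕ∞ :=
  restrictedMin G a d (bands G d (Set.Iio m)) ∅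

/-- Middle force: crossings from `A^d_m`. -/
noncomputable def middleForce (G : SimpleGraph V) (a d m : ℕ) : ℕ∞ :=
  restrictedMin G a d (band G d m) ∅

/-- End force: crossings from `A^d_(m+1), …, A^d_d`. -/
noncomputable def endForce (G : SimpleGraph V) (a d m : ℕ) : ℕ∞ :=
  restrictedMin G a d (bands G d (Set.Ioc m d)) ∅

/-- Front plus-force with parameter `k`: at most `(r + 1) * a` crossings from
`A^d_m ∪ … ∪ A^d_(m+r)`, for every `r < k`. -/
noncomputable def frontPlus (G : SimpleGraph V) (a d m k : ℕ) : ℕ∞ :=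
  restrictedMin G a d (bands G d (Set.Iio m))
    {R | ∃ r : ℕ, r < k ∧ R = (bands G d (Set.Icc m (m + r)), (r + 1) * a)}

/-- Middle plus-force: at most `a` crossings from `A^d_(m+1)`. -/
noncomputable def middlePlus (G : SimpleGraph V) (a d m : ℕ) : ℕ∞ :=
  restrictedMin G a d (band G d m) {(band G d (m + 1), a)}

/-- End plus-force: at most `a - 1` crossings from `A^d_m`. -/
noncomputable def endPlus (G : SimpleGraph V) (a d m : ℕ) : ℕ∞ :=
  restrictedMin G a d (bands G d (Set.Ioc m d)) {(band G d m, a - 1)}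

/-- Front star-force. -/
noncomputable def frontStar (G : SimpleGraph V) (a d m k : ℕ) : WithTop ℤ :=
  min (toExtInt (frontPlus G a d m k)) (toExtInt (frontForce G a d m) + 1)

/-- Middle star-force. -/
noncomputable def middleStar (G : SimpleGraph V) (a d m : ℕ) : WithTop ℤ :=
  min (toExtInt (middlePlus G a d m)) (toExtInt (middleForce G a d m) + 1)

/-- End star-force (it may be `-1`). -/
noncomputable def endStar (G : SimpleGraph V) (a d m : ℕ) : WithTop ℤ :=
  min (toExtInt (endPlus G a d m) + ((-1 : ℤ) : WithTop ℤ)) (toExtInt (endForce G a d m))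

end CartPath

/-! The proof is by induction on `n`, starting at `n = d + max k 1 - 2`. Take a good drawing of the
product with the fewest crossings. If some copy of `G` is involved in at least `a` crossings, delete
it and join the two links at each of its vertices into one edge. This draws the product with one
copy fewer and loses at least `a` crossings, so the induction hypothesis applies
(`exists_delete_layer`).

Otherwise the drawing is `a`-restricted, and so is every window of `d + 1` consecutive copies. Band
`i` of the window starting at copy `s` lies in band `i + s` of the whole drawing, and different
bands are disjoint, so forces found in different windows may be added. The first window supplies the
front bands, the last one the end bands, and each of the `n - d + 1` windows one middle band. If
every count reaches its star-force, the total is at least `a(d-1) - b + a(n-d+1) = an - b`. The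
plus-forces take care of deficits, which are of one crossing at most: a middle band with `a - 1`
crossings is followed by one with at least `a + 1`, or, if it is the last, by end bands with one
crossing more than the end star-force; a deficit in the front comes with an initial run of middle
bands whose total exceeds `a` per band (`le_sum_of_compensated`, `le_crossings_of_restricted`).

The topological input is that a drawing with finitely many crossings can be made good without new
crossings (`exists_isGood`): if two edges cross at `p` and meet again at `q`, then rerouting inside
a small disc about `p`, possibly with an exchange of the pieces between `q` and the disc, removes
`p` (`exists_uncross`). -/

section

open Set unitInterval

/-! ### Simple arcs in the plane -/

theorem IsArcBetween.symm {p q : Plane} {A : Set Plane} (h : IsArcBetween p q A) :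
    IsArcBetween q p A := by
  obtain ⟨γ, hγ, rfl⟩ := h
  refine ⟨γ.symm, fun s t hst => ?_, γ.symm_range⟩
  exact unitInterval.symm_inj.1 (hγ hst)

theorem IsArcBetween.ne {p q : Plane} {A : Set Plane} (h : IsArcBetween p q A) : p ≠ q := by
  obtain ⟨γ, hγ, rfl⟩ := h
  intro hpq
  have : γ 0 = γ 1 := by rw [γ.source, γ.target, hpq]
  exact zero_ne_one (hγ this)

theorem IsArcBetween.left_mem {p q : Plane} {A : Set Plane} (h : IsArcBetween p q A) : p ∈ A := by
  obtain ⟨γ, -, rfl⟩ := h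
  exact ⟨0, γ.source⟩

theorem IsArcBetween.right_mem {p q : Plane} {A : Set Plane} (h : IsArcBetween p q A) : q ∈ A :=
  h.symm.left_mem

theorem IsArcBetween.isCompact {p q : Plane} {A : Set Plane} (h : IsArcBetween p q A) :
    IsCompact A := by
  obtain ⟨γ, -, rfl⟩ := h
  exact isCompact_range γ.continuous

/-- Two arcs that meet only in a common end form an arc. -/
theorem IsArcBetween.concat {x y z : Plane} {A B : Set Plane} (hA : IsArcBetween x y A)
    (hB : IsArcBetween y z B) (h : A ∩ B ⊆ {y}) : IsArcBetween x z (A ∪ B) := by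
  obtain ⟨α, hα, rfl⟩ := hA
  obtain ⟨β, hβ, rfl⟩ := hB
  have key : ∀ s t : I, α s = β t → s = 1 ∧ t = 0 := by
    intro s t hst
    have hy : α s = y := h ⟨⟨s, rfl⟩, ⟨t, hst.symm⟩⟩
    exact ⟨hα (hy.trans α.target.symm), hβ ((hst.symm.trans hy).trans β.source.symm)⟩
  refine ⟨α.trans β, fun s t hst => ?_, Path.trans_range α β⟩
  rw [Path.trans_apply, Path.trans_apply] at hst
  apply Subtype.ext
  split_ifs at hst with h1 h2 h2
  · have := congrArg Subtype.val (hα hst)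
    simp only at this
    linarith
  · have := congrArg Subtype.val (key _ _ hst).2
    simp only [Icc.coe_zero] at this
    linarith
  · have := congrArg Subtype.val (key _ _ hst.symm).2
    simp only [Icc.coe_zero] at this
    linarith
  · have := congrArg Subtype.val (hβ hst)
    simp only at this
    linarith

/-- Some simple arc inside `A` joins `x` to `y`, or `x` and `y` are the same point of `A`. -/
def ArcIn (A : Set Plane) (x y : Plane) : Prop :=
  (x = y ∧ x ∈ A) ∨ ∃ C ⊆ A, IsArcBetween x y C

theorem ArcIn.mono {A B : Set Plane} {x y : Plane} (h : ArcIn A x y) (hAB : A ⊆ B) :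
    ArcIn B x y := by
  rcases h with ⟨h, hx⟩ | ⟨C, hC, h⟩
  · exact Or.inl ⟨h, hAB hx⟩
  · exact Or.inr ⟨C, hC.trans hAB, h⟩

theorem ArcIn.symm {A : Set Plane} {x y : Plane} (h : ArcIn A x y) : ArcIn A y x := by
  rcases h with ⟨rfl, hx⟩ | ⟨C, hC, h⟩
  · exact Or.inl ⟨rfl, hx⟩
  · exact Or.inr ⟨C, hC, h.symm⟩

theorem ArcIn.exists_arc {A : Set Plane} {x y : Plane} (h : ArcIn A x y) (hxy : x ≠ y) :
    ∃ C ⊆ A, IsArcBetween x y C :=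
  h.resolve_left fun h => hxy h.1

theorem ArcIn.concat {x y z : Plane} {A B : Set Plane} (hA : ArcIn A x y)
    (hB : ArcIn B y z) (h : A ∩ B ⊆ {y}) : ArcIn (A ∪ B) x z := by
  rcases hA with ⟨rfl, -⟩ | ⟨C, hC, hA⟩
  · exact hB.mono subset_union_right
  rcases hB with ⟨rfl, -⟩ | ⟨C', hC', hB⟩
  · exact Or.inr ⟨C, hC.trans subset_union_left, hA⟩
  · exact Or.inr ⟨C ∪ C', union_subset_union hC hC',
      hA.concat hB ((inter_subset_inter hC hC').trans h)⟩

theorem arcIn_image_Icc {x y : Plane} (γ : Path x y) (hγ : Function.Injective γ) {s t : I}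
    (hst : s ≤ t) : ArcIn (γ '' Icc s t) (γ s) (γ t) := by
  rcases hst.eq_or_lt with rfl | hlt
  · exact Or.inl ⟨rfl, s, ⟨le_rfl, le_rfl⟩, rfl⟩
  · refine Or.inr ⟨_, Subset.rfl, γ.subpath s t, ?_, γ.range_subpath_of_le s t hst⟩
    intro u v huv
    have h1 : Icc.convexComb s t u = Icc.convexComb s t v := hγ huv
    have h2 := congrArg Subtype.val h1
    have hlt' : (s : ℝ) < t := hlt
    apply Subtype.ext
    simp only [Icc.convexComb] at h2
    have h3 : ((t : ℝ) - s) * ((u : ℝ) - v) = 0 := by linear_combination h2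
    rcases mul_eq_zero.1 h3 with h | h <;> linarith

/-- Follow the first arc up to its first point on the second, then continue along the second. Hence
a chain of arcs with arbitrary intersections still contains a simple arc, and redrawn edges need not
be checked for self-intersections. -/
theorem ArcIn.trans {x y z : Plane} {A B : Set Plane} (hA : ArcIn A x y) (hB : ArcIn B y z) :
    ArcIn (A ∪ B) x z := by
  rcases hA with ⟨rfl, -⟩ | ⟨C, hC, α, hα, rfl⟩
  · exact hB.mono subset_union_right
  rcases hB with ⟨rfl, -⟩ | ⟨C', hC', β, hβ, rfl⟩
  · exact Or.inr ⟨_, hC.trans subset_union_left, α, hα, rfl⟩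
  have hcl : IsClosed (α ⁻¹' range β) :=
    (isCompact_range β.continuous).isClosed.preimage α.continuous
  obtain ⟨t, ⟨s, hs⟩, hmin⟩ := hcl.isCompact.exists_isLeast ⟨1, 0, by simp⟩
  have h1 := arcIn_image_Icc α hα (zero_le (a := t))
  have h2 := arcIn_image_Icc β hβ (le_one' (t := s))
  rw [α.source] at h1
  rw [β.target, hs] at h2
  refine (h1.concat h2 ?_).mono (union_subset_union
    ((image_subset_range _ _).trans hC) ((image_subset_range _ _).trans hC'))
  rintro _ ⟨⟨u, hu, rfl⟩, v, hv, huv⟩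
  have : t ≤ u := hmin ⟨v, huv⟩
  rw [mem_singleton_iff, le_antisymm hu.2 this]

theorem arcIn_segment (x y : Plane) : ArcIn (segment ℝ x y) x y := by
  by_cases h : x = y
  · exact Or.inl ⟨h, left_mem_segment ℝ x y⟩
  refine Or.inr ⟨_, Subset.rfl, ⟨⟨fun t => AffineMap.lineMap x y (t : ℝ), by fun_prop⟩, by simp,
    by simp⟩, fun s t hst => Subtype.ext (AffineMap.lineMap_injective ℝ h hst), ?_⟩
  rw [segment_eq_image_lineMap]
  ext z
  simp

/-- The parts of an arc through the centre `p` of a small disc: from its start to an earlier point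
`q`, from `q` to the disc, and from the disc to its end. -/
theorem exists_arc_pieces {x y p : Plane} (γ : Path x y) (hγ : Function.Injective γ) {s t : I}
    (hp : γ t = p) {r : ℝ} (hr : 0 < r)
    (hB : Disjoint (γ '' Icc 0 s) (Metric.closedBall p r)) (hy : y ∉ Metric.closedBall p r) :
    ∃ (x₀ x₁ : Plane) (K₀ K₁ K₂ : Set Plane), x₀ ∈ Metric.sphere p r ∧ x₁ ∈ Metric.sphere p r ∧
      x₀ ≠ x₁ ∧ ArcIn K₀ x (γ s) ∧ ArcIn K₁ (γ s) x₀ ∧ ArcIn K₂ x₁ y ∧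
      K₀ ⊆ range γ ∧ K₁ ⊆ range γ ∧ K₂ ⊆ range γ ∧
      Disjoint K₀ (Metric.closedBall p r) ∧ K₁ ∩ Metric.closedBall p r ⊆ {x₀} ∧
      K₂ ∩ Metric.closedBall p r ⊆ {x₁} ∧ K₀ ∩ K₁ ⊆ {γ s} ∧ K₀ ∩ K₂ ⊆ ∅ ∧ K₁ ∩ K₂ ⊆ ∅ := by
  set B := Metric.closedBall p r with hBdef
  have hcl : IsClosed (γ ⁻¹' B) := Metric.isClosed_closedBall.preimage γ.continuous
  have htB : t ∈ γ ⁻¹' B := by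
    change γ t ∈ B
    rw [hp]; exact Metric.mem_closedBall_self hr.le
  -- The first and last times in the disc. What the arc does between them is discarded, so it may
  -- leave and re-enter the disc. A first or last visit in the open disc could be moved further out,
  -- so both points are on the circle.
  obtain ⟨t₀, ht₀, hmin⟩ := hcl.isCompact.exists_isLeast ⟨t, htB⟩
  obtain ⟨t₁, ht₁, hmax⟩ := hcl.isCompact.exists_isGreatest ⟨t, htB⟩
  have h0 : γ t₀ ∈ Metric.sphere p r := by
    by_contra hns
    have hball : γ t₀ ∈ Metric.ball p r := lt_of_le_of_ne ht₀ hns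
    have hs0 : s < t₀ := by
      by_contra hle
      exact hB.le_bot ⟨⟨t₀, ⟨zero_le, not_lt.1 hle⟩, rfl⟩, ht₀⟩
    have hopen : IsOpen (γ ⁻¹' Metric.ball p r) := Metric.isOpen_ball.preimage γ.continuous
    obtain ⟨l, hl, hl'⟩ := exists_Ioc_subset_of_mem_nhds (hopen.mem_nhds hball) ⟨s, hs0⟩
    obtain ⟨w, hw1, hw2⟩ := exists_between hl
    exact absurd (hmin (Metric.ball_subset_closedBall (hl' ⟨hw1, hw2.le⟩))) (not_le.2 hw2)
  have h1 : γ t₁ ∈ Metric.sphere p r := by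
    by_contra hns
    have hball : γ t₁ ∈ Metric.ball p r := lt_of_le_of_ne ht₁ hns
    have hs1 : t₁ < 1 := by
      refine lt_of_le_of_ne le_one' fun h => hy ?_
      rw [← γ.target, ← h]; exact ht₁
    have hopen : IsOpen (γ ⁻¹' Metric.ball p r) := Metric.isOpen_ball.preimage γ.continuous
    obtain ⟨l, hl, hl'⟩ := exists_Ico_subset_of_mem_nhds (hopen.mem_nhds hball) ⟨1, hs1⟩
    obtain ⟨w, hw1, hw2⟩ := exists_between hl
    exact absurd (hmax (Metric.ball_subset_closedBall (hl' ⟨hw1.le, hw2⟩))) (not_le.2 hw1)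
  have hpn : γ t ∉ Metric.sphere p r := by
    rw [hp, Metric.mem_sphere, dist_self]; exact hr.ne
  have ht0 : t₀ < t := lt_of_le_of_ne (hmin htB) fun h => hpn (h ▸ h0)
  have ht1 : t < t₁ := lt_of_le_of_ne (hmax htB) fun h => hpn (h ▸ h1)
  have hs0 : s < t₀ := by
    by_contra hle
    exact hB.le_bot ⟨⟨t₀, ⟨zero_le, not_lt.1 hle⟩, rfl⟩, ht₀⟩
  have a0 := arcIn_image_Icc γ hγ (zero_le (a := s))
  have a2 := arcIn_image_Icc γ hγ (le_one' (t := t₁))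
  rw [γ.source] at a0
  rw [γ.target] at a2
  refine ⟨γ t₀, γ t₁, _, _, _, h0, h1, fun h => (ht0.trans ht1).ne (hγ h), a0,
    arcIn_image_Icc γ hγ hs0.le, a2, image_subset_range _ _, image_subset_range _ _,
    image_subset_range _ _, hB, ?_, ?_, ?_, ?_, ?_⟩
  · rintro _ ⟨⟨u, hu, rfl⟩, huB⟩
    rw [mem_singleton_iff, le_antisymm hu.2 (hmin huB)]
  · rintro _ ⟨⟨u, hu, rfl⟩, huB⟩
    rw [mem_singleton_iff, le_antisymm hu.1 (hmax huB)]
  · rintro _ ⟨⟨u, hu, rfl⟩, v, hv, huv⟩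
    rw [hγ huv] at hv
    rw [mem_singleton_iff, le_antisymm hu.2 hv.1]
  · rintro _ ⟨⟨u, hu, rfl⟩, v, hv, huv⟩
    rw [hγ huv] at hv
    exact absurd (hu.2.trans_lt (hs0.trans (ht0.trans ht1))) (not_lt.2 hv.1)
  · rintro _ ⟨⟨u, hu, rfl⟩, v, hv, huv⟩
    rw [hγ huv] at hv
    exact absurd (hu.2.trans_lt (ht0.trans ht1)) (not_lt.2 hv.1)

/-- Among the pairings `ab, cd` and `cb, ad` of four points on a circle, one has disjoint chords. -/
theorem disjoint_segment_or_of_sphere {p a b c d : Plane} {r : ℝ} (ha : a ∈ Metric.sphere p r)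
    (hb : b ∈ Metric.sphere p r) (hc : c ∈ Metric.sphere p r)
    (hab : a ≠ b) (hac : a ≠ c) (hbc : b ≠ c) (hbd : b ≠ d) :
    Disjoint (segment ℝ a b) (segment ℝ c d) ∨ Disjoint (segment ℝ c b) (segment ℝ a d) := by
  by_contra! h
  obtain ⟨h1, h2⟩ := h
  obtain ⟨y, ⟨α, α', h0α, h0α', hα, hy⟩, β, β', h0β, h0β', hβ, hy'⟩ := not_disjoint_iff.1 h1
  obtain ⟨z, ⟨γ, γ', h0γ, h0γ', hγ, hz⟩, δ, δ', h0δ, h0δ', hδ, hz'⟩ := not_disjoint_iff.1 h2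
  have hind : AffineIndependent ℝ ![a, b, c] :=
    (EuclideanGeometry.cospherical_def _ |>.2 ⟨p, r, fun x hx => hx⟩ :
      EuclideanGeometry.Cospherical (Metric.sphere p r)).affineIndependent_of_mem_of_ne
      ha hb hc hab hac hbc
  have key : ∀ u v w : ℝ, u + v + w = 0 → u • a + v • b + w • c = 0 → u = 0 ∧ v = 0 ∧ w = 0 := by
    intro u v w h0 h1
    have := (affineIndependent_iff.1 hind) Finset.univ ![u, v, w]
      (by simpa [Fin.sum_univ_three] using h0) (by simpa [Fin.sum_univ_three] using h1)
    exact ⟨by simpa using this 0, by simpa using this 1, by simpa using this 2⟩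
  have e1 : α • a + α' • b = β • c + β' • d := hy.trans hy'.symm
  have e2 : γ • c + γ' • b = δ • a + δ' • d := hz.trans hz'.symm
  -- Eliminate `d` from the two chord intersections. The resulting affine relation among `a`, `b`,
  -- `c` is trivial, and its coefficients at `a` and `c` are, up to sign, sums of nonnegative terms,
  -- so each of these terms vanishes.
  obtain ⟨k1, k2, k3⟩ := key (δ' * α + β' * δ) (δ' * α' - β' * γ') (-(δ' * β + β' * γ))
    (by linear_combination δ' * hα - β' * hγ - δ' * hβ + β' * hδ)
    (by linear_combination (norm := module) δ' • e1 - β' • e2)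
  by_cases hβ' : β' = 0
  · have hβ1 : β = 1 := by linarith
    rw [hβ', hβ1] at e1
    have := key α α' (-1) (by linarith) (by linear_combination (norm := module) e1)
    linarith [this.2.2]
  · have hpos : 0 < β' := lt_of_le_of_ne h0β' (Ne.symm hβ')
    have q1 : 0 ≤ δ' * α := by positivity
    have q2 : 0 ≤ β' * δ := by positivity
    have q3 : 0 ≤ δ' * β := by positivity
    have q4 : 0 ≤ β' * γ := by positivity
    have hδ0 : δ = 0 := by
      have : β' * δ = 0 := by linarith
      exact (mul_eq_zero.1 this).resolve_left hβ'
    have hδ1 : δ' = 1 := by linarith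
    rw [hδ1] at k1 k3 q1 q3
    have hα0 : α = 0 := by linarith
    have hβ0 : β = 0 := by linarith
    have hα1 : α' = 1 := by linarith
    have hβ1 : β' = 1 := by linarith
    rw [hα0, hα1, hβ0, hβ1] at e1
    exact hbd (by simpa using e1)

/-! ### Crossing points, and the redrawing of edges -/

namespace Drawing

variable {W : Type*} {G : SimpleGraph W}

/-- The points of the plane at which the drawing has a crossing. -/
def crossSet (D : Drawing G) : Set Plane :=
  {p | p ∉ range D.pt ∧ ∃ e ∈ G.edgeSet, ∃ f ∈ G.edgeSet, e ≠ f ∧ p ∈ D.curve e ∧ p ∈ D.curve f}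

theorem image_snd_crossingPoints (D : Drawing G) : Prod.snd '' D.crossingPoints = D.crossSet := by
  ext p
  constructor
  · rintro ⟨⟨c, p⟩, ⟨e, he, f, hf, hef, -, hpe, hpf, hp⟩, rfl⟩
    exact ⟨hp, e, he, f, hf, hef, hpe, hpf⟩
  · rintro ⟨hp, e, he, f, hf, hef, hpe, hpf⟩
    exact ⟨(s(e, f), p), ⟨e, he, f, hf, hef, rfl, hpe, hpf, hp⟩, rfl⟩

theorem eq_or_eq_of_mem_curve (D : Drawing G) {p : Plane} (hp : p ∉ range D.pt) {e f g : Sym2 W}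
    (he : e ∈ G.edgeSet) (hf : f ∈ G.edgeSet) (hg : g ∈ G.edgeSet) (hef : e ≠ f)
    (hpe : p ∈ D.curve e) (hpf : p ∈ D.curve f) (hpg : p ∈ D.curve g) : g = e ∨ g = f := by
  by_contra! h
  exact hp (D.no_triple e he f hf g hg hef h.1.symm h.2.symm p hpe hpf hpg)

/-- No three edges meet at a crossing, so the point determines the pair. Crossings can therefore be
counted as points of the plane, which survive a change of edges or of graph. -/
theorem injOn_snd_crossingPoints (D : Drawing G) : InjOn Prod.snd D.crossingPoints := by
  rintro ⟨c, p⟩ ⟨e, he, f, hf, hef, hc, hpe, hpf, hp⟩ ⟨c', p'⟩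
    ⟨e', he', f', hf', hef', hc', hpe', hpf', hp'⟩ h
  simp only at h hc hc' hpe hpf hp hpe' hpf' hp'
  subst h hc hc'
  have h1 := D.eq_or_eq_of_mem_curve hp he hf he' hef hpe hpf hpe'
  have h2 := D.eq_or_eq_of_mem_curve hp he hf hf' hef hpe hpf hpf'
  rcases h1 with rfl | rfl <;> rcases h2 with rfl | rfl
  · exact absurd rfl hef'
  · rfl
  · rw [Sym2.eq_swap]
  · exact absurd rfl hef'

theorem encard_crossSet (D : Drawing G) : D.crossSet.encard = D.numCrossings := by
  rw [← image_snd_crossingPoints, D.injOn_snd_crossingPoints.encard_image]; rfl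

theorem image_fst_crossingPoints (D : Drawing G) : Prod.fst '' D.crossingPoints = D.crossings := by
  ext c
  simp [crossings]

theorem encard_crossings_le (D : Drawing G) : D.crossings.encard ≤ D.numCrossings := by
  rw [← image_fst_crossingPoints]
  exact encard_image_le _ _

/-- To draw a graph it suffices to give, for every edge, a set that contains an arc. -/
theorem exists_of_arcIn (pt : W → Plane) (hpt : Function.Injective pt) (K : Sym2 W → Set Plane)
    (harc : ∀ u v, G.Adj u v → ArcIn (K s(u, v)) (pt u) (pt v))
    (havoid : ∀ e ∈ G.edgeSet, ∀ w, pt w ∈ K e → w ∈ e)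
    (htriple : ∀ e ∈ G.edgeSet, ∀ f ∈ G.edgeSet, ∀ g ∈ G.edgeSet, e ≠ f → e ≠ g → f ≠ g →
      ∀ p, p ∈ K e → p ∈ K f → p ∈ K g → p ∈ range pt) :
    ∃ D : Drawing G, D.pt = pt ∧ ∀ e ∈ G.edgeSet, D.curve e ⊆ K e := by
  have h : ∀ e : Sym2 W, ∃ C : Set Plane, e ∈ G.edgeSet →
      C ⊆ K e ∧ ∀ u v, e = s(u, v) → IsArcBetween (pt u) (pt v) C := by
    intro e
    induction e using Sym2.ind with | _ u v => ?_
    by_cases he : s(u, v) ∈ G.edgeSet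
    · have hadj : G.Adj u v := he
      obtain ⟨C, hC, hC'⟩ := (harc u v hadj).exists_arc (hpt.ne hadj.ne)
      refine ⟨C, fun _ => ⟨hC, fun u' v' huv => ?_⟩⟩
      rcases Sym2.eq_iff.1 huv with ⟨rfl, rfl⟩ | ⟨rfl, rfl⟩
      · exact hC'
      · exact hC'.symm
    · exact ⟨∅, fun h => absurd h he⟩
  choose C hC using h
  refine ⟨⟨pt, hpt, C, fun u v huv => (hC _ huv).2 u v rfl,
    fun e he w hw => havoid e he w ((hC e he).1 hw), ?_⟩, rfl, fun e he => (hC e he).1⟩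
  intro e he f hf g hg hef heg hfg p hpe hpf hpg
  exact htriple e he f hf g hg hef heg hfg p ((hC e he).1 hpe) ((hC f hf).1 hpf) ((hC g hg).1 hpg)

theorem isCompact_curve (D : Drawing G) {e : Sym2 W} (he : e ∈ G.edgeSet) :
    IsCompact (D.curve e) := by
  induction e using Sym2.ind with | _ u v => ?_
  exact (D.curve_arc u v he).isCompact

theorem pt_mem_curve (D : Drawing G) {e : Sym2 W} (he : e ∈ G.edgeSet) {w : W} (hw : w ∈ e) :
    D.pt w ∈ D.curve e := by
  induction e using Sym2.ind with | _ u v => ?_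
  rcases Sym2.mem_iff.1 hw with rfl | rfl
  · exact (D.curve_arc _ _ he).left_mem
  · exact (D.curve_arc _ _ he).right_mem

/-- The curves of two edges may be redrawn so as to get rid of a crossing `p`, if the new curves
add no common points off a set `B` that contains `p` and meets no other edge. -/
theorem exists_replace_pair (D : Drawing G) {e f : Sym2 W} (he : e ∈ G.edgeSet)
    (hf : f ∈ G.edgeSet) (hef : e ≠ f) {p : Plane} {B Ke Kf : Set Plane} (hpB : p ∈ B)
    (hB : ∀ g ∈ G.edgeSet, g ≠ e → g ≠ f → Disjoint (D.curve g) B)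
    (harce : ∀ u v, e = s(u, v) → ArcIn Ke (D.pt u) (D.pt v))
    (harcf : ∀ u v, f = s(u, v) → ArcIn Kf (D.pt u) (D.pt v))
    (hKe : Ke ⊆ D.curve e ∪ D.curve f ∪ B) (hKf : Kf ⊆ D.curve e ∪ D.curve f ∪ B)
    (hin : ∀ x ∈ Ke, x ∈ Kf → x ∉ B)
    (hout : ∀ x ∈ Ke, x ∈ Kf → x ∉ B → x ∈ D.curve e ∧ x ∈ D.curve f)
    (hpte : ∀ w, D.pt w ∈ Ke → w ∈ e) (hptf : ∀ w, D.pt w ∈ Kf → w ∈ f) :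
    ∃ D' : Drawing G, D'.crossSet ⊆ D.crossSet \ {p} := by
  classical
  set K : Sym2 W → Set Plane := fun g => if g = e then Ke else if g = f then Kf else D.curve g
    with hK
  have hKe' : K e = Ke := by simp [hK]
  have hKf' : K f = Kf := by simp [hK, hef.symm]
  have hKg : ∀ g, g ≠ e → g ≠ f → K g = D.curve g := fun g h1 h2 => by simp [hK, h1, h2]
  have hBef : ∀ x ∈ B, ∀ g ∈ G.edgeSet, x ∈ K g → g = e ∨ g = f := by
    intro x hx g hg hxg
    by_contra! h
    rw [hKg g h.1 h.2] at hxg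
    exact (hB g hg h.1 h.2).le_bot ⟨hxg, hx⟩
  have hBpair : ∀ x ∈ B, ∀ g ∈ G.edgeSet, ∀ h ∈ G.edgeSet, x ∈ K g → x ∈ K h → g = h := by
    intro x hx g hg h hh hxg hxh
    rcases hBef x hx g hg hxg with rfl | rfl <;> rcases hBef x hx h hh hxh with rfl | rfl
    · rfl
    · rw [hKe'] at hxg; rw [hKf'] at hxh
      exact absurd hx (hin x hxg hxh)
    · rw [hKf'] at hxg; rw [hKe'] at hxh
      exact absurd hx (hin x hxh hxg)
    · rfl
  -- Off `B`, the new curves through `x` are matched injectively with old curves through `x`, by the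
  -- identity or by the exchange of `e` and `f`. So triple points and crossings off `B` are
  -- inherited from `D`. The exchange is needed only if a new curve took `x` from the other edge,
  -- and then `hout` forbids that both new curves contain `x`.
  have hperm : ∀ x ∉ B, ∃ τ : Sym2 W → Sym2 W,
      InjOn τ {g | g ∈ G.edgeSet ∧ x ∈ K g} ∧
      ∀ g ∈ G.edgeSet, x ∈ K g → τ g ∈ G.edgeSet ∧ x ∈ D.curve (τ g) := by
    intro x hx
    by_cases hid : ∀ g ∈ G.edgeSet, x ∈ K g → x ∈ D.curve g
    · exact ⟨id, injOn_id _, fun g hg hxg => ⟨hg, hid g hg hxg⟩⟩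
    push Not at hid
    obtain ⟨g₀, hg₀, hxg₀, hxg₀'⟩ := hid
    have hnot : ¬ (x ∈ Ke ∧ x ∈ Kf) := by
      rintro ⟨h1, h2⟩
      obtain ⟨h3, h4⟩ := hout x h1 h2 hx
      by_cases h5 : g₀ = e
      · exact hxg₀' (h5 ▸ h3)
      by_cases h6 : g₀ = f
      · exact hxg₀' (h6 ▸ h4)
      exact hxg₀' (hKg g₀ h5 h6 ▸ hxg₀)
    refine ⟨Equiv.swap e f, (Equiv.swap e f).injective.injOn, fun g hg hxg => ?_⟩
    by_cases h5 : g = e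
    · subst h5
      rw [Equiv.swap_apply_left]
      refine ⟨hf, ?_⟩
      rw [hKe'] at hxg
      rcases hKe hxg with (h | h) | h
      · exfalso
        by_cases h7 : g₀ = g
        · exact hxg₀' (h7 ▸ h)
        by_cases h8 : g₀ = f
        · rw [h8, hKf'] at hxg₀
          exact hnot ⟨hxg, hxg₀⟩
        exact hxg₀' (hKg g₀ h7 h8 ▸ hxg₀)
      · exact h
      · exact absurd h hx
    by_cases h6 : g = f
    · subst h6
      rw [Equiv.swap_apply_right]
      refine ⟨he, ?_⟩
      rw [hKf'] at hxg
      rcases hKf hxg with (h | h) | h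
      · exact h
      · exfalso
        by_cases h7 : g₀ = g
        · exact hxg₀' (h7 ▸ h)
        by_cases h8 : g₀ = e
        · rw [h8, hKe'] at hxg₀
          exact hnot ⟨hxg₀, hxg⟩
        exact hxg₀' (hKg g₀ h8 h7 ▸ hxg₀)
      · exact absurd h hx
    rw [Equiv.swap_apply_of_ne_of_ne h5 h6]
    exact ⟨hg, hKg g h5 h6 ▸ hxg⟩
  obtain ⟨D', hpt, hcurve⟩ := exists_of_arcIn (G := G) D.pt D.pt_injective K
    (by
      intro u v huv
      by_cases h5 : s(u, v) = e
      · rw [h5, hKe']; exact harce u v h5.symm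
      by_cases h6 : s(u, v) = f
      · rw [h6, hKf']; exact harcf u v h6.symm
      rw [hKg _ h5 h6]
      exact Or.inr ⟨_, Subset.rfl, D.curve_arc u v huv⟩)
    (by
      intro g hg w hw
      by_cases h5 : g = e
      · subst h5; rw [hKe'] at hw; exact hpte w hw
      by_cases h6 : g = f
      · subst h6; rw [hKf'] at hw; exact hptf w hw
      rw [hKg _ h5 h6] at hw
      exact D.curve_avoids g hg w hw)
    (by
      intro g₁ h₁ g₂ h₂ g₃ h₃ h12 h13 h23 x hx1 hx2 hx3
      by_cases hxB : x ∈ B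
      · exact absurd (hBpair x hxB g₁ h₁ g₂ h₂ hx1 hx2) h12
      obtain ⟨τ, hτ, hτ'⟩ := hperm x hxB
      exact D.no_triple (τ g₁) (hτ' g₁ h₁ hx1).1 (τ g₂) (hτ' g₂ h₂ hx2).1 (τ g₃) (hτ' g₃ h₃ hx3).1
        (hτ.ne ⟨h₁, hx1⟩ ⟨h₂, hx2⟩ h12) (hτ.ne ⟨h₁, hx1⟩ ⟨h₃, hx3⟩ h13)
        (hτ.ne ⟨h₂, hx2⟩ ⟨h₃, hx3⟩ h23) x
        (hτ' g₁ h₁ hx1).2 (hτ' g₂ h₂ hx2).2 (hτ' g₃ h₃ hx3).2)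
  refine ⟨D', ?_⟩
  rintro x ⟨hxpt, g, hg, h, hh, hgh, hxg, hxh⟩
  have hxg' := hcurve g hg hxg
  have hxh' := hcurve h hh hxh
  have hxB : x ∉ B := fun hxB => hgh (hBpair x hxB g hg h hh hxg' hxh')
  obtain ⟨τ, hτ, hτ'⟩ := hperm x hxB
  refine ⟨⟨hpt ▸ hxpt, τ g, (hτ' g hg hxg').1, τ h, (hτ' h hh hxh').1,
    hτ.ne ⟨hg, hxg'⟩ ⟨hh, hxh'⟩ hgh, (hτ' g hg hxg').2, (hτ' h hh hxh').2⟩, ?_⟩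
  rintro rfl
  exact hxB hpB

/-- A parametrisation of an edge that visits `q` before `p`. -/
theorem exists_path (D : Drawing G) {e : Sym2 W} (he : e ∈ G.edgeSet) {p q : Plane}
    (hp : p ∈ D.curve e) (hq : q ∈ D.curve e) (hpq : p ≠ q) :
    ∃ (u v : W) (γ : Path (D.pt u) (D.pt v)) (s t : I), e = s(u, v) ∧ Function.Injective γ ∧
      range γ = D.curve e ∧ s < t ∧ γ s = q ∧ γ t = p := by
  induction e using Sym2.ind with | _ u v => ?_
  obtain ⟨γ, hγ, hr⟩ := D.curve_arc u v he
  rw [← hr] at hp hq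
  obtain ⟨t, rfl⟩ := hp
  obtain ⟨s, rfl⟩ := hq
  rcases lt_trichotomy s t with h | rfl | h
  · exact ⟨u, v, γ, s, t, rfl, hγ, hr, h, rfl, rfl⟩
  · exact absurd rfl hpq
  · refine ⟨v, u, γ.symm, σ s, σ t, Sym2.eq_swap, ?_, ?_, ?_, by simp, by simp⟩
    · exact fun a b hab => unitInterval.symm_inj.1 (hγ hab)
    · rw [γ.symm_range, hr]
    · exact unitInterval.symm_lt_symm.2 h

end Drawing

/-! ### From arbitrary drawings to good drawings -/

theorem ArcIn.left_mem {A : Set Plane} {x y : Plane} (h : ArcIn A x y) : x ∈ A := by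
  rcases h with ⟨-, h⟩ | ⟨C, hC, h⟩
  · exact h
  · exact hC h.left_mem

theorem ArcIn.right_mem {A : Set Plane} {x y : Plane} (h : ArcIn A x y) : y ∈ A :=
  h.symm.left_mem

namespace Drawing

variable {W : Type*} {G : SimpleGraph W}

/-- If two edges cross at `p` and have a second common point, then the drawing can be changed so
that the crossing `p` disappears and no new one arises. -/
theorem exists_uncross [Finite W] (D : Drawing G) (hfin : D.crossSet.Finite) {e f : Sym2 W}
    (he : e ∈ G.edgeSet) (hf : f ∈ G.edgeSet) (hef : e ≠ f) {p q : Plane} (hpq : p ≠ q)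
    (hp : p ∉ range D.pt) (hpe : p ∈ D.curve e) (hpf : p ∈ D.curve f) (hqe : q ∈ D.curve e)
    (hqf : q ∈ D.curve f) : ∃ D' : Drawing G, D'.crossSet ⊆ D.crossSet \ {p} := by
  obtain ⟨u, v, γ, s, t, heuv, hγ, hγr, hst, hγs, hγt⟩ := D.exists_path he hpe hqe hpq
  obtain ⟨u', v', γ', s', t', hfuv, hγ', hγr', hst', hγs', hγt'⟩ := D.exists_path hf hpf hqf hpq
  -- All that the disc about `p` has to avoid: vertices, other edges, other crossings, and both
  -- edges from their starts up to `q`. The set is closed because there are finitely many crossings.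
  set Z : Set Plane := range D.pt ∪ (⋃ g ∈ {g | g ∈ G.edgeSet ∧ g ≠ e ∧ g ≠ f}, D.curve g) ∪
    D.crossSet \ {p} ∪ γ '' Icc 0 s ∪ γ' '' Icc 0 s' with hZ
  have hZc : IsClosed Z := by
    refine ((((finite_range _).isClosed.union ?_).union hfin.sdiff.isClosed).union ?_).union ?_
    · exact (toFinite _).isClosed_biUnion fun g hg => (D.isCompact_curve hg.1).isClosed
    · exact (isCompact_Icc.image γ.continuous).isClosed
    · exact (isCompact_Icc.image γ'.continuous).isClosed
  have hpZ : p ∉ Z := by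
    rintro ((((h | h) | h) | ⟨w, hw, h⟩) | ⟨w, hw, h⟩)
    · exact hp h
    · obtain ⟨g, ⟨hg, hge, hgf⟩, hpg⟩ := mem_iUnion₂.1 h
      rcases D.eq_or_eq_of_mem_curve hp he hf hg hef hpe hpf hpg with h | h
      · exact hge h
      · exact hgf h
    · exact h.2 rfl
    · rw [hγ (h.trans hγt.symm)] at hw
      exact absurd hst (not_lt.2 hw.2)
    · rw [hγ' (h.trans hγt'.symm)] at hw
      exact absurd hst' (not_lt.2 hw.2)
  obtain ⟨r, hr, hrZ⟩ := Metric.nhds_basis_closedBall.mem_iff.1 (hZc.isOpen_compl.mem_nhds hpZ)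
  set B := Metric.closedBall p r with hBdef
  have hBpt : ∀ w, D.pt w ∉ B := fun w hw =>
    hrZ hw (Or.inl (Or.inl (Or.inl (Or.inl ⟨w, rfl⟩))))
  have hBg : ∀ g ∈ G.edgeSet, g ≠ e → g ≠ f → Disjoint (D.curve g) B := fun g hg hge hgf =>
    disjoint_left.2 fun x hx hxB => hrZ hxB
      (Or.inl (Or.inl (Or.inl (Or.inr (mem_iUnion₂.2 ⟨g, ⟨hg, hge, hgf⟩, hx⟩)))))
  have hBe : Disjoint (γ '' Icc 0 s) B :=
    disjoint_left.2 fun x hx hxB => hrZ hxB (Or.inl (Or.inr hx))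
  have hBf : Disjoint (γ' '' Icc 0 s') B :=
    disjoint_left.2 fun x hx hxB => hrZ hxB (Or.inr hx)
  have hBef : ∀ x ∈ B, x ∈ D.curve e → x ∈ D.curve f → x = p := by
    intro x hx hxe hxf
    by_contra hne
    refine hrZ hx (Or.inl (Or.inl (Or.inr ⟨⟨?_, e, he, f, hf, hef, hxe, hxf⟩, hne⟩)))
    rintro ⟨w, rfl⟩
    exact hBpt w hx
  obtain ⟨a, b, K₀, K₁, K₂, ha, hb, hab, aK₀, aK₁, aK₂, hK₀, hK₁, hK₂, hK₀B, hK₁B, hK₂B, hK₀₁,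
    hK₀₂, hK₁₂⟩ := exists_arc_pieces γ hγ hγt hr hBe (hBpt v)
  obtain ⟨c, d, L₀, L₁, L₂, hc, hd, hcd, aL₀, aL₁, aL₂, hL₀, hL₁, hL₂, hL₀B, hL₁B, hL₂B, hL₀₁,
    hL₀₂, hL₁₂⟩ := exists_arc_pieces γ' hγ' hγt' hr hBf (hBpt v')
  rw [hγr] at hK₀ hK₁ hK₂
  rw [hγr'] at hL₀ hL₁ hL₂
  rw [hγs] at aK₀ aK₁ hK₀₁
  rw [hγs'] at aL₀ aL₁ hL₀₁
  have hsph : ∀ x ∈ Metric.sphere p r, x ∈ D.curve e → x ∈ D.curve f → False := by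
    intro x hx hxe hxf
    rw [hBef x (Metric.sphere_subset_closedBall hx) hxe hxf, Metric.mem_sphere, dist_self] at hx
    exact hr.ne hx
  have hac : a ≠ c := fun h => hsph a ha (hK₁ aK₁.right_mem) (h ▸ hL₁ aL₁.right_mem)
  have hbc : b ≠ c := fun h => hsph b hb (hK₂ aK₂.left_mem) (h ▸ hL₁ aL₁.right_mem)
  have hbd : b ≠ d := fun h => hsph b hb (hK₂ aK₂.left_mem) (h ▸ hL₂ aL₂.left_mem)
  have hseg : ∀ x ∈ Metric.sphere p r, ∀ y ∈ Metric.sphere p r, segment ℝ x y ⊆ B :=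
    fun x hx y hy => (convex_closedBall p r).segment_subset
      (Metric.sphere_subset_closedBall hx) (Metric.sphere_subset_closedBall hy)
  have hpB : p ∈ B := Metric.mem_closedBall_self hr.le
  have orient : ∀ (g : Sym2 W) (w w' : W) (K : Set Plane), g = s(w, w') →
      ArcIn K (D.pt w) (D.pt w') → ∀ x y, g = s(x, y) → ArcIn K (D.pt x) (D.pt y) := by
    intro g w w' K hg h x y hxy
    rcases Sym2.eq_iff.1 (hxy.symm.trans hg) with ⟨rfl, rfl⟩ | ⟨rfl, rfl⟩
    · exact h
    · exact h.symm
  -- If the chords `ab` and `cd` are disjoint, each edge keeps its own pieces and `p` was no genuine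
  -- crossing. Otherwise `cb` and `ad` are disjoint, and the edges exchange their pieces between `q`
  -- and the disc.
  rcases disjoint_segment_or_of_sphere ha hb hc hab hac hbc hbd with hdis | hdis
  · refine D.exists_replace_pair he hf hef (B := B) (Ke := K₀ ∪ K₁ ∪ segment ℝ a b ∪ K₂)
      (Kf := L₀ ∪ L₁ ∪ segment ℝ c d ∪ L₂) hpB hBg
      (orient e u v _ heuv (((aK₀.trans aK₁).trans (arcIn_segment a b)).trans aK₂))
      (orient f u' v' _ hfuv (((aL₀.trans aL₁).trans (arcIn_segment c d)).trans aL₂))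
      ?_ ?_ ?_ ?_ ?_ ?_
    · rintro x (((h | h) | h) | h)
      exacts [Or.inl (Or.inl (hK₀ h)), Or.inl (Or.inl (hK₁ h)), Or.inr (hseg a ha b hb h),
        Or.inl (Or.inl (hK₂ h))]
    · rintro x (((h | h) | h) | h)
      exacts [Or.inl (Or.inr (hL₀ h)), Or.inl (Or.inr (hL₁ h)), Or.inr (hseg c hc d hd h),
        Or.inl (Or.inr (hL₂ h))]
    · intro x hx hx' hxB
      have h1 : x ∈ segment ℝ a b := by
        rcases hx with ((h | h) | h) | h
        · exact absurd hxB (disjoint_left.1 hK₀B h)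
        · rw [hK₁B ⟨h, hxB⟩]; exact left_mem_segment ℝ a b
        · exact h
        · rw [hK₂B ⟨h, hxB⟩]; exact right_mem_segment ℝ a b
      have h2 : x ∈ segment ℝ c d := by
        rcases hx' with ((h | h) | h) | h
        · exact absurd hxB (disjoint_left.1 hL₀B h)
        · rw [hL₁B ⟨h, hxB⟩]; exact left_mem_segment ℝ c d
        · exact h
        · rw [hL₂B ⟨h, hxB⟩]; exact right_mem_segment ℝ c d
      exact disjoint_left.1 hdis h1 h2
    · intro x hx hx' hxB
      constructor
      · rcases hx with ((h | h) | h) | h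
        exacts [hK₀ h, hK₁ h, absurd (hseg a ha b hb h) hxB, hK₂ h]
      · rcases hx' with ((h | h) | h) | h
        exacts [hL₀ h, hL₁ h, absurd (hseg c hc d hd h) hxB, hL₂ h]
    · intro w hx
      apply D.curve_avoids e he w
      rcases hx with ((h | h) | h) | h
      exacts [hK₀ h, hK₁ h, absurd (hseg a ha b hb h) (hBpt w), hK₂ h]
    · intro w hx
      apply D.curve_avoids f hf w
      rcases hx with ((h | h) | h) | h
      exacts [hL₀ h, hL₁ h, absurd (hseg c hc d hd h) (hBpt w), hL₂ h]
  · have hend : ∀ w, D.pt w ∈ K₁ → D.pt w = q := by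
      -- A vertex on `e` is one of its ends. The final end lies on `K₂`, which misses `K₁`; the
      -- initial end lies on `K₀`, which meets `K₁` only in `q`. So the exchanged piece brings no
      -- vertex to `f` except possibly `q`, which is on `f` already.
      intro w hw
      have hwe := D.curve_avoids e he w (hK₁ hw)
      rw [heuv] at hwe
      rcases Sym2.mem_iff.1 hwe with rfl | rfl
      · exact hK₀₁ ⟨aK₀.left_mem, hw⟩
      · exact (hK₁₂ ⟨hw, aK₂.right_mem⟩).elim
    have hend' : ∀ w, D.pt w ∈ L₁ → D.pt w = q := by
      intro w hw
      have hwf := D.curve_avoids f hf w (hL₁ hw)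
      rw [hfuv] at hwf
      rcases Sym2.mem_iff.1 hwf with rfl | rfl
      · exact hL₀₁ ⟨aL₀.left_mem, hw⟩
      · exact (hL₁₂ ⟨hw, aL₂.right_mem⟩).elim
    refine D.exists_replace_pair he hf hef (B := B) (Ke := K₀ ∪ L₁ ∪ segment ℝ c b ∪ K₂)
      (Kf := L₀ ∪ K₁ ∪ segment ℝ a d ∪ L₂) hpB hBg
      (orient e u v _ heuv (((aK₀.trans aL₁).trans (arcIn_segment c b)).trans aK₂))
      (orient f u' v' _ hfuv (((aL₀.trans aK₁).trans (arcIn_segment a d)).trans aL₂))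
      ?_ ?_ ?_ ?_ ?_ ?_
    · rintro x (((h | h) | h) | h)
      exacts [Or.inl (Or.inl (hK₀ h)), Or.inl (Or.inr (hL₁ h)), Or.inr (hseg c hc b hb h),
        Or.inl (Or.inl (hK₂ h))]
    · rintro x (((h | h) | h) | h)
      exacts [Or.inl (Or.inr (hL₀ h)), Or.inl (Or.inl (hK₁ h)), Or.inr (hseg a ha d hd h),
        Or.inl (Or.inr (hL₂ h))]
    · intro x hx hx' hxB
      have h1 : x ∈ segment ℝ c b := by
        rcases hx with ((h | h) | h) | h
        · exact absurd hxB (disjoint_left.1 hK₀B h)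
        · rw [hL₁B ⟨h, hxB⟩]; exact left_mem_segment ℝ c b
        · exact h
        · rw [hK₂B ⟨h, hxB⟩]; exact right_mem_segment ℝ c b
      have h2 : x ∈ segment ℝ a d := by
        rcases hx' with ((h | h) | h) | h
        · exact absurd hxB (disjoint_left.1 hL₀B h)
        · rw [hK₁B ⟨h, hxB⟩]; exact left_mem_segment ℝ a d
        · exact h
        · rw [hL₂B ⟨h, hxB⟩]; exact right_mem_segment ℝ a d
      exact disjoint_left.1 hdis h1 h2
    · intro x hx hx' hxB
      -- Common points of `K₀` and `K₁`, or of `L₀` and `L₁`, are new as meetings of two edges, but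
      -- they can only be `q`, which is on both old curves.
      rcases hx with ((h | h) | h) | h <;> rcases hx' with ((h' | h') | h') | h'
      · exact ⟨hK₀ h, hL₀ h'⟩
      · rw [hK₀₁ ⟨h, h'⟩]; exact ⟨hqe, hqf⟩
      · exact absurd (hseg a ha d hd h') hxB
      · exact ⟨hK₀ h, hL₂ h'⟩
      · rw [hL₀₁ ⟨h', h⟩]; exact ⟨hqe, hqf⟩
      · exact ⟨hK₁ h', hL₁ h⟩
      · exact absurd (hseg a ha d hd h') hxB
      · exact (hL₁₂ ⟨h, h'⟩).elim
      iterate 4 exact absurd (hseg c hc b hb h) hxB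
      · exact ⟨hK₂ h, hL₀ h'⟩
      · exact (hK₁₂ ⟨h', h⟩).elim
      · exact absurd (hseg a ha d hd h') hxB
      · exact ⟨hK₂ h, hL₂ h'⟩
    · intro w hx
      apply D.curve_avoids e he w
      rcases hx with ((h | h) | h) | h
      · exact hK₀ h
      · rw [hend' w h]; exact hqe
      · exact absurd (hseg c hc b hb h) (hBpt w)
      · exact hK₂ h
    · intro w hx
      apply D.curve_avoids f hf w
      rcases hx with ((h | h) | h) | h
      · exact hL₀ h
      · rw [hend w h]; exact hqf
      · exact absurd (hseg a ha d hd h) (hBpt w)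
      · exact hL₂ h

/-- Distinct edges of a simple graph share at most one end. So of two common points of two edges, at
least one is a crossing, and it can be removed. -/
theorem eq_of_pt_mem_of_pt_mem (D : Drawing G) {e f : Sym2 W} (he : e ∈ G.edgeSet)
    (hf : f ∈ G.edgeSet) (hef : e ≠ f) {p q : Plane} (hp : p ∈ range D.pt) (hq : q ∈ range D.pt)
    (hpe : p ∈ D.curve e) (hpf : p ∈ D.curve f) (hqe : q ∈ D.curve e) (hqf : q ∈ D.curve f) :
    p = q := by
  obtain ⟨w, rfl⟩ := hp
  obtain ⟨w', rfl⟩ := hq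
  by_contra hne
  have hww : w ≠ w' := fun h => hne (h ▸ rfl)
  refine hef ?_
  rw [(Sym2.mem_and_mem_iff hww).1 ⟨D.curve_avoids e he w hpe, D.curve_avoids e he w' hqe⟩,
    (Sym2.mem_and_mem_iff hww).1 ⟨D.curve_avoids f hf w hpf, D.curve_avoids f hf w' hqf⟩]

/-- A drawing with finitely many crossings can be replaced by a good one without more crossings. -/
theorem exists_isGood [Finite W] (D : Drawing G) (hfin : D.crossSet.Finite) :
    ∃ D' : Drawing G, D'.IsGood ∧ D'.crossSet ⊆ D.crossSet := by
  induction hn : D.crossSet.ncard using Nat.strong_induction_on generalizing D with | _ n ih => ?_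
  by_cases hmeet : ∀ e ∈ G.edgeSet, ∀ f ∈ G.edgeSet, e ≠ f →
      (D.curve e ∩ D.curve f).Subsingleton
  · refine ⟨D, ⟨fun e he f hf hef w hwe hwf x hx => ?_, hmeet⟩, Subset.rfl⟩
    exact hmeet e he f hf hef hx ⟨D.pt_mem_curve he hwe, D.pt_mem_curve hf hwf⟩
  push Not at hmeet
  obtain ⟨e, he, f, hf, hef, hns⟩ := hmeet
  obtain ⟨p, hp, q, hq, hpq⟩ := hns
  have key : ∀ p q : Plane, p ∉ range D.pt → p ∈ D.curve e ∩ D.curve f →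
      q ∈ D.curve e ∩ D.curve f → p ≠ q → ∃ D' : Drawing G, D'.IsGood ∧ D'.crossSet ⊆ D.crossSet := by
    intro p q hpt hp hq hpq
    obtain ⟨D', hD'⟩ := D.exists_uncross hfin he hf hef hpq hpt hp.1 hp.2 hq.1 hq.2
    have hpD : p ∈ D.crossSet := ⟨hpt, e, he, f, hf, hef, hp.1, hp.2⟩
    have hlt : D'.crossSet.ncard < n := by
      rw [← hn]
      refine ncard_lt_ncard ⟨hD'.trans sdiff_subset, fun h => ?_⟩ hfin
      exact (hD' (h hpD)).2 rfl
    obtain ⟨D'', hg, hs⟩ := ih _ hlt D' (hfin.subset (hD'.trans sdiff_subset)) rfl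
    exact ⟨D'', hg, hs.trans (hD'.trans sdiff_subset)⟩
  by_cases hpt : p ∈ range D.pt
  · by_cases hqt : q ∈ range D.pt
    · exact absurd (D.eq_of_pt_mem_of_pt_mem he hf hef hpt hqt hp.1 hp.2 hq.1 hq.2) hpq
    · exact key q p hqt hq hp hpq.symm
  · exact key p q hpt hp hq hpq

/-- If the crossing number is finite, it is at least the number of crossings of a good drawing. -/
theorem exists_isGood_numCrossings_le [Finite W] (h : crossingNumber G ≠ ⊤) :
    ∃ D : Drawing G, D.IsGood ∧ D.numCrossings ≤ crossingNumber G := by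
  have hne : Nonempty (Drawing G) := by
    by_contra hempty
    rw [not_nonempty_iff] at hempty
    exact h (iInf_of_empty _)
  obtain ⟨D, hD⟩ := ENat.exists_eq_iInf fun D : Drawing G => D.numCrossings
  have hfin : D.crossSet.Finite := by
    rw [← encard_ne_top_iff, encard_crossSet, hD]; exact h
  obtain ⟨D', hg, hs⟩ := D.exists_isGood hfin
  refine ⟨D', hg, ?_⟩
  rw [← encard_crossSet]
  calc _ ≤ D.crossSet.encard := encard_le_encard hs
    _ = _ := by rw [encard_crossSet, hD]; rfl

end Drawing

/-! ### Drawings induced by subdivisions and by embeddings -/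

namespace Drawing

variable {W W' : Type*} {G : SimpleGraph W} {G' : SimpleGraph W'}

/-- A drawing of `G` gives a drawing of `G'` if every edge of `G'` corresponds to a set of edges of
`G` that contains a path joining its ends, and these sets share no edges and no new vertices. -/
theorem exists_of_subdivision (D : Drawing G) (φ : W' → W) (hφ : Function.Injective φ)
    (R : Sym2 W' → Sym2 W → Prop) (hedge : ∀ e g, R e g → g ∈ G.edgeSet)
    (harc : ∀ u v, G'.Adj u v →
      ArcIn (⋃ g ∈ {g | R s(u, v) g}, D.curve g) (D.pt (φ u)) (D.pt (φ v)))
    (huniq : ∀ e e' g, R e g → R e' g → e = e')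
    (hend : ∀ e g w, R e g → φ w ∈ g → w ∈ e)
    (hnew : ∀ e e' g g' w, R e g → R e' g' → w ∈ g → w ∈ g' → w ∉ range φ → e = e') :
    ∃ D' : Drawing G', ∀ p ∈ D'.crossSet, p ∉ range D.pt ∧
      ∃ e f g h, R e g ∧ R f h ∧ g ≠ h ∧ p ∈ D.curve g ∧ p ∈ D.curve h := by
  -- A common point of two new curves that was a vertex of `D` remains a vertex, because a
  -- suppressed vertex lies on the path of only one edge. So every new crossing is an old one.
  have hvert : ∀ e f g h p, R e g → R f h → e ≠ f → p ∈ D.curve g → p ∈ D.curve h →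
      p ∈ range D.pt → p ∈ range (D.pt ∘ φ) := by
    rintro e f g h _ heg hfh hef hg hh ⟨w, rfl⟩
    by_contra hw
    refine hef (hnew e f g h w heg hfh (D.curve_avoids g (hedge e g heg) w hg)
      (D.curve_avoids h (hedge f h hfh) w hh) ?_)
    rintro ⟨w', rfl⟩
    exact hw ⟨w', rfl⟩
  obtain ⟨D', hpt, hcurve⟩ := exists_of_arcIn (G := G') (D.pt ∘ φ) (D.pt_injective.comp hφ)
    (fun e => ⋃ g ∈ {g | R e g}, D.curve g) harc
    (by
      intro e _ w hw
      obtain ⟨g, hg, hwg⟩ := mem_iUnion₂.1 hw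
      exact hend e g w hg (D.curve_avoids g (hedge e g hg) _ hwg))
    (by
      intro e₁ _ e₂ _ e₃ _ h12 h13 h23 p hp1 hp2 hp3
      obtain ⟨g₁, hg₁, hp1⟩ := mem_iUnion₂.1 hp1
      obtain ⟨g₂, hg₂, hp2⟩ := mem_iUnion₂.1 hp2
      obtain ⟨g₃, hg₃, hp3⟩ := mem_iUnion₂.1 hp3
      have k12 : g₁ ≠ g₂ := fun h => h12 (huniq _ _ _ hg₁ (h ▸ hg₂))
      have k13 : g₁ ≠ g₃ := fun h => h13 (huniq _ _ _ hg₁ (h ▸ hg₃))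
      have k23 : g₂ ≠ g₃ := fun h => h23 (huniq _ _ _ hg₂ (h ▸ hg₃))
      exact hvert e₁ e₂ g₁ g₂ p hg₁ hg₂ h12 hp1 hp2 (D.no_triple g₁ (hedge _ _ hg₁) g₂
        (hedge _ _ hg₂) g₃ (hedge _ _ hg₃) k12 k13 k23 p hp1 hp2 hp3))
  refine ⟨D', ?_⟩
  rintro p ⟨hp, e, he, f, hf, hef, hpe, hpf⟩
  obtain ⟨g, hg, hpg⟩ := mem_iUnion₂.1 (hcurve e he hpe)
  obtain ⟨h, hh, hph⟩ := mem_iUnion₂.1 (hcurve f hf hpf)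
  refine ⟨fun hpr => hp (hpt ▸ hvert e f g h p hg hh hef hpg hph hpr),
    e, f, g, h, hg, hh, fun hgh => hef (huniq _ _ _ hg (hgh ▸ hh)), hpg, hph⟩

/-- The drawing of `G'` induced by an injective homomorphism to a graph that is drawn. -/
def comap (D : Drawing G) (φ : G' →g G) (hφ : Function.Injective φ) : Drawing G' where
  pt := D.pt ∘ φ
  pt_injective := D.pt_injective.comp hφ
  curve e := D.curve (e.map φ)
  curve_arc u v huv := D.curve_arc (φ u) (φ v) (φ.map_rel huv)
  curve_avoids e he w hw := by
    have := D.curve_avoids _ (φ.map_mem_edgeSet he) (φ w) hw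
    obtain ⟨w', hw', h⟩ := Sym2.mem_map.1 this
    exact hφ h ▸ hw'
  no_triple e he f hf g hg hef heg hfg p hpe hpf hpg := by
    have hinj := Sym2.map.injective hφ
    obtain ⟨w, rfl⟩ := D.no_triple _ (φ.map_mem_edgeSet he) _ (φ.map_mem_edgeSet hf) _
      (φ.map_mem_edgeSet hg) (hinj.ne hef) (hinj.ne heg) (hinj.ne hfg) p hpe hpf hpg
    obtain ⟨w', -, rfl⟩ := Sym2.mem_map.1 (D.curve_avoids _ (φ.map_mem_edgeSet he) w hpe)
    exact ⟨w', rfl⟩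

theorem IsGood.comap {D : Drawing G} (hD : D.IsGood) (φ : G' →g G)
    (hφ : Function.Injective φ) : (D.comap φ hφ).IsGood := by
  have hinj := Sym2.map.injective hφ
  refine ⟨fun e he f hf hef w hwe hwf => ?_, fun e he f hf hef => ?_⟩
  · exact hD.1 _ (φ.map_mem_edgeSet he) _ (φ.map_mem_edgeSet hf) (hinj.ne hef) (φ w)
      (Sym2.mem_map.2 ⟨w, hwe, rfl⟩) (Sym2.mem_map.2 ⟨w, hwf, rfl⟩)
  · exact hD.2 _ (φ.map_mem_edgeSet he) _ (φ.map_mem_edgeSet hf) (hinj.ne hef)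

theorem map_mem_crossings {D : Drawing G} {φ : G' →g G} {hφ : Function.Injective φ}
    {c : Sym2 (Sym2 W')} (hc : c ∈ (D.comap φ hφ).crossings) :
    c.map (Sym2.map φ) ∈ D.crossings := by
  obtain ⟨p, e, he, f, hf, hef, hcef, hpe, hpf, hp⟩ := hc
  simp only at hcef
  subst hcef
  refine ⟨p, _, φ.map_mem_edgeSet he, _, φ.map_mem_edgeSet hf,
    (Sym2.map.injective hφ).ne hef, rfl, hpe, hpf, ?_⟩
  rintro ⟨w, rfl⟩
  obtain ⟨w', -, rfl⟩ := Sym2.mem_map.1 (D.curve_avoids _ (φ.map_mem_edgeSet he) w hpe)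
  exact hp ⟨w', rfl⟩

theorem encard_crossings_comap_le {D : Drawing G} {φ : G' →g G} {hφ : Function.Injective φ}
    {B' : Set (Sym2 (Sym2 W'))} {B : Set (Sym2 (Sym2 W))}
    (h : ∀ c ∈ B', c.map (Sym2.map φ) ∈ B) :
    ((D.comap φ hφ).crossings ∩ B').encard ≤ (D.crossings ∩ B).encard := by
  rw [← (Sym2.map.injective (Sym2.map.injective hφ)).encard_image]
  refine encard_le_encard ?_
  rintro _ ⟨c, ⟨hc, hcB⟩, rfl⟩
  exact ⟨map_mem_crossings hc, h c hcB⟩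

end Drawing

/-! ### Deletion of a copy of `G` -/

namespace CartPath

variable {V : Type*}

theorem prod_edge_cases {G : SimpleGraph V} {n : ℕ} {u v : V × Fin (n + 1)}
    (h : (prod G n).Adj u v) :
    (∃ x y t, G.Adj x y ∧ u = (x, t) ∧ v = (y, t)) ∨
      ∃ x t t', u = (x, t) ∧ v = (x, t') ∧ (t'.val = t.val + 1 ∨ t.val = t'.val + 1) := by
  obtain ⟨x, t⟩ := u
  obtain ⟨y, t'⟩ := v
  rcases SimpleGraph.boxProd_adj.1 h with ⟨h1, h2⟩ | ⟨h1, h2⟩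
  · simp only at h1 h2
    subst h2
    exact Or.inl ⟨x, y, t, h1, rfl, rfl⟩
  · simp only at h1 h2
    subst h2
    rw [SimpleGraph.pathGraph_adj] at h1
    exact Or.inr ⟨x, t, t', rfl, rfl, by omega⟩

theorem prod_adj_copy {G : SimpleGraph V} {n : ℕ} {x y : V} (h : G.Adj x y) (t : Fin (n + 1)) :
    (prod G n).Adj (x, t) (y, t) :=
  SimpleGraph.boxProd_adj.2 (Or.inl ⟨h, rfl⟩)

theorem prod_adj_link (G : SimpleGraph V) {n : ℕ} (x : V) {t t' : Fin (n + 1)}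
    (h : t'.val = t.val + 1) : (prod G n).Adj (x, t) (x, t') :=
  SimpleGraph.boxProd_adj.2 (Or.inr ⟨SimpleGraph.pathGraph_adj.2 (Or.inl h.symm), rfl⟩)

/-- The edges of `G □ P_(n+1)` that are on the path to which the edge `e` of `G □ P_n` corresponds
when the `i`-th copy of `G` is deleted. -/
def LayerPath (G : SimpleGraph V) {n : ℕ} (i : Fin (n + 2)) (e : Sym2 (V × Fin (n + 1)))
    (g : Sym2 (V × Fin (n + 2))) : Prop :=
  (∃ x y t, G.Adj x y ∧ e = s((x, t), (y, t)) ∧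
    g = s((x, i.succAbove t), (y, i.succAbove t))) ∨
  ∃ x t t' r r', t'.val = t.val + 1 ∧ r'.val = r.val + 1 ∧ i.succAbove t ≤ r ∧
    r' ≤ i.succAbove t' ∧ e = s((x, t), (x, t')) ∧ g = s((x, r), (x, r'))

theorem val_succAbove {n : ℕ} (i : Fin (n + 1)) (t : Fin n) :
    (i.succAbove t).val = if t.val < i.val then t.val else t.val + 1 := by
  simp only [Fin.succAbove, Fin.lt_def, Fin.val_castSucc]
  split_ifs <;> simp

theorem LayerPath.mem_edgeSet {G : SimpleGraph V} {n : ℕ} {i : Fin (n + 2)}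
    {e : Sym2 (V × Fin (n + 1))} {g : Sym2 (V × Fin (n + 2))} (h : LayerPath G i e g) :
    g ∈ (prod G (n + 1)).edgeSet := by
  rcases h with ⟨x, y, t, hxy, rfl, rfl⟩ | ⟨x, t, t', r, r', -, h2, -, -, rfl, rfl⟩
  · exact prod_adj_copy hxy _
  · exact prod_adj_link G x h2

theorem LayerPath.notMem_copyEdges {G : SimpleGraph V} {n : ℕ} {i : Fin (n + 2)}
    {e : Sym2 (V × Fin (n + 1))} {g : Sym2 (V × Fin (n + 2))} (h : LayerPath G i e g) :
    g ∉ copyEdges G (n + 1) i.val := by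
  rintro ⟨u, v, huv, k, hk, hg⟩
  have hki : k = i := Fin.ext (by exact_mod_cast hk)
  subst hki
  rcases h with ⟨x, y, t, hxy, rfl, rfl⟩ | ⟨x, t, t', r, r', -, h2, -, -, rfl, rfl⟩
  · simp only [Sym2.eq_iff, Prod.mk.injEq] at hg
    have := Fin.succAbove_ne k t
    tauto
  · simp only [Sym2.eq_iff, Prod.mk.injEq] at hg
    have := huv.ne
    grind

theorem arcIn_layerPath {G : SimpleGraph V} {n : ℕ} (D : Drawing (prod G (n + 1)))
    (i : Fin (n + 2)) (x : V) {t t' : Fin (n + 1)} (h : t'.val = t.val + 1) :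
    ArcIn (⋃ g ∈ {g | LayerPath G i s((x, t), (x, t')) g}, D.curve g)
      (D.pt (x, i.succAbove t)) (D.pt (x, i.succAbove t')) := by
  have h1 := val_succAbove i t
  have h2 := val_succAbove i t'
  have one : ∀ r r' : Fin (n + 2), r'.val = r.val + 1 → i.succAbove t ≤ r →
      r' ≤ i.succAbove t' → ArcIn (⋃ g ∈ {g | LayerPath G i s((x, t), (x, t')) g}, D.curve g)
        (D.pt (x, r)) (D.pt (x, r')) := fun r r' hr h3 h4 =>
    Or.inr ⟨_, subset_biUnion_of_mem (u := fun g => D.curve g)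
      (show s((x, r), (x, r')) ∈ {g | LayerPath G i s((x, t), (x, t')) g} from
        Or.inr ⟨x, t, t', r, r', h, hr, h3, h4, rfl, rfl⟩),
      D.curve_arc _ _ (prod_adj_link G x hr)⟩
  -- The path is a single link, or two links through the deleted copy if `i` lies between the two
  -- positions.
  by_cases hi : (i.succAbove t').val = (i.succAbove t).val + 1
  · exact one _ _ hi le_rfl le_rfl
  · have ha : i.val = (i.succAbove t).val + 1 := by split_ifs at h1 h2 <;> omega
    have hb : (i.succAbove t').val = i.val + 1 := by split_ifs at h1 h2 <;> omega
    have := (one _ i ha le_rfl (Fin.le_def.2 (by omega))).trans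
      (one i _ hb (Fin.le_def.2 (by omega)) le_rfl)
    rwa [union_self] at this

theorem exists_delete_layer {G : SimpleGraph V} {n : ℕ} (D : Drawing (prod G (n + 1)))
    (i : Fin (n + 2)) : ∃ D' : Drawing (prod G n), D'.numCrossings +
      (D.crossings ∩ crossPairs (copyEdges G (n + 1) i.val) (prod G (n + 1)).edgeSet).encard ≤
        D.numCrossings := by
  obtain ⟨D', hD'⟩ := D.exists_of_subdivision (G' := prod G n)
    (fun w => (w.1, i.succAbove w.2))
    (fun w w' h => Prod.ext (Prod.mk.inj h).1 (Fin.succAbove_right_injective (Prod.mk.inj h).2))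
    (LayerPath G i)
    (fun _ _ h => h.mem_edgeSet)
    (by
      intro u v huv
      rcases prod_edge_cases huv with ⟨x, y, t, hxy, rfl, rfl⟩ | ⟨x, t, t', rfl, rfl, h | h⟩
      · exact Or.inr ⟨_, subset_biUnion_of_mem (u := fun g => D.curve g)
          (show s((x, i.succAbove t), (y, i.succAbove t)) ∈
            {g | LayerPath G i s((x, t), (y, t)) g} from Or.inl ⟨x, y, t, hxy, rfl, rfl⟩),
          D.curve_arc _ _ (prod_adj_copy hxy _)⟩
      · exact arcIn_layerPath D i x h
      · rw [Sym2.eq_swap]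
        exact (arcIn_layerPath D i x h).symm)
    (by
      rintro e e' g (⟨x, y, t, hxy, rfl, rfl⟩ | ⟨x, t, t', r, r', h1, h2, h3, h4, rfl, rfl⟩)
        (⟨x₂, y₂, t₂, hxy₂, rfl, hg⟩ | ⟨x₂, t₂, t₂', r₂, r₂', k1, k2, k3, k4, rfl, hg⟩)
      · simp only [Sym2.eq_iff, Prod.mk.injEq, Fin.succAbove_right_inj] at hg ⊢
        tauto
      · simp only [Sym2.eq_iff, Prod.mk.injEq] at hg
        have := hxy.ne
        grind
      · simp only [Sym2.eq_iff, Prod.mk.injEq] at hg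
        have := hxy₂.ne
        grind
      · have e1 := val_succAbove i t
        have e2 := val_succAbove i t'
        have e3 := val_succAbove i t₂
        have e4 := val_succAbove i t₂'
        simp only [Fin.le_def] at h3 h4 k3 k4
        simp only [Sym2.eq_iff, Prod.mk.injEq] at hg
        have hx : x = x₂ := by tauto
        have hr : r.val = r₂.val := by
          rcases hg with ⟨⟨-, h⟩, -⟩ | ⟨⟨-, h⟩, -, h'⟩
          · rw [h]
          · rw [h] at h2; rw [h'] at h2; omega
        have ht : t = t₂ := Fin.ext (by split_ifs at e1 e2 e3 e4 <;> omega)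
        have ht' : t' = t₂' := Fin.ext (by omega)
        rw [hx, ht, ht'])
    (by
      rintro e g ⟨x₀, t₀⟩ (⟨x, y, t, hxy, rfl, rfl⟩ | ⟨x, t, t', r, r', h1, h2, h3, h4, rfl, rfl⟩) hw
      · simpa only [Sym2.mem_iff, Prod.mk.injEq, Fin.succAbove_right_inj] using hw
      · have e1 := val_succAbove i t
        have e2 := val_succAbove i t'
        have e3 := val_succAbove i t₀
        simp only [Fin.le_def] at h3 h4
        simp only [Sym2.mem_iff, Prod.mk.injEq] at hw ⊢
        have hx : x₀ = x := by tauto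
        have hr : (i.succAbove t₀).val = r.val ∨ (i.succAbove t₀).val = r'.val := by
          rcases hw with ⟨-, h⟩ | ⟨-, h⟩ <;> rw [h] <;> simp
        have ht : t₀.val = t.val ∨ t₀.val = t'.val := by split_ifs at e1 e2 e3 <;> omega
        simp only [Fin.ext_iff]
        tauto)
    (by
      -- Only a link that jumps over copy `i` has a path through `(x, i)`, and there is just one
      -- such link for each `x`.
      have hmem : ∀ (e : Sym2 (V × Fin (n + 1))) (g : Sym2 (V × Fin (n + 2))) (x : V),
          LayerPath G i e g → (x, i) ∈ g → ∃ t t' : Fin (n + 1), t'.val = t.val + 1 ∧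
            (i.succAbove t).val ≤ i.val ∧ i.val ≤ (i.succAbove t').val ∧
            e = s((x, t), (x, t')) := by
        rintro e g x₀ (⟨x, y, t, hxy, rfl, rfl⟩ | ⟨x, t, t', r, r', h1, h2, h3, h4, rfl, rfl⟩) hw
        · simp only [Sym2.mem_iff, Prod.mk.injEq] at hw
          have := (Fin.succAbove_ne i t).symm
          tauto
        · simp only [Sym2.mem_iff, Prod.mk.injEq] at hw
          simp only [Fin.le_def] at h3 h4
          have hx : x₀ = x := by tauto
          subst hx
          refine ⟨t, t', h1, ?_, ?_, rfl⟩ <;> rcases hw with ⟨-, h⟩ | ⟨-, h⟩ <;> rw [← h] at h2 <;>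
            first | (rw [← h] at h3; omega) | (rw [← h] at h4; omega)
      rintro e e' g g' ⟨x, k⟩ heg heg' hw hw' hk
      have hki : k = i := by
        by_contra hne
        obtain ⟨t, rfl⟩ := Fin.exists_succAbove_eq hne
        exact hk ⟨(x, t), rfl⟩
      subst hki
      obtain ⟨t, t', h1, h2, h3, rfl⟩ := hmem e g x heg hw
      obtain ⟨t₂, t₂', k1, k2, k3, rfl⟩ := hmem e' g' x heg' hw'
      have e1 := val_succAbove k t
      have e2 := val_succAbove k t'
      have e3 := val_succAbove k t₂
      have e4 := val_succAbove k t₂'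
      have ht : t = t₂ := Fin.ext (by split_ifs at e1 e2 e3 e4 <;> omega)
      have ht' : t' = t₂' := Fin.ext (by omega)
      rw [ht, ht'])
  refine ⟨D', ?_⟩
  set R := crossPairs (copyEdges G (n + 1) i.val) (prod G (n + 1)).edgeSet with hR
  set T := Prod.snd '' {c | c ∈ D.crossingPoints ∧ c.1 ∈ R} with hT
  have hTsub : T ⊆ D.crossSet := by
    rw [← D.image_snd_crossingPoints]
    exact image_mono fun c hc => hc.1
  have hTcard : (D.crossings ∩ R).encard ≤ T.encard := by
    rw [hT, (D.injOn_snd_crossingPoints.mono fun c hc => hc.1).encard_image]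
    refine le_trans (encard_le_encard ?_) (encard_image_le Prod.fst _)
    rintro c ⟨⟨p, hp⟩, hcR⟩
    exact ⟨(c, p), ⟨hp, hcR⟩, rfl⟩
  -- Exactly two edges pass through a crossing. At a crossing of `D'` both belong to the paths,
  -- hence not to copy `i`, whereas at a point of `T` one of them does.
  have hdisj : Disjoint D'.crossSet T := by
    rw [disjoint_left]
    rintro p hp ⟨⟨c, p'⟩, ⟨⟨e, he, f, hf, hef, hc, hpe, hpf, -⟩, e₁, he₁, f₁, -, hcR⟩, hpp⟩
    obtain ⟨hpn, e', f', g, h, hg, hh, hgh, hpg, hph⟩ := hD' p hp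
    simp only at hpp hc hpe hpf hcR
    subst hpp
    have he₁' : e₁ = e ∨ e₁ = f := by
      have : e₁ ∈ s(e, f) := by rw [← hc, hcR]; exact Sym2.mem_mk_left _ _
      exact Sym2.mem_iff.1 this
    have hmem : e₁ ∈ (prod G (n + 1)).edgeSet ∧ p' ∈ D.curve e₁ := by
      rcases he₁' with rfl | rfl
      exacts [⟨he, hpe⟩, ⟨hf, hpf⟩]
    rcases D.eq_or_eq_of_mem_curve hpn (hg.mem_edgeSet) (hh.mem_edgeSet) hmem.1 hgh hpg hph hmem.2 with
      rfl | rfl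
    · exact hg.notMem_copyEdges he₁
    · exact hh.notMem_copyEdges he₁
  have hsub : D'.crossSet ⊆ D.crossSet := by
    intro p hp
    obtain ⟨hpn, e', f', g, h, hg, hh, hgh, hpg, hph⟩ := hD' p hp
    exact ⟨hpn, g, hg.mem_edgeSet, h, hh.mem_edgeSet, hgh, hpg, hph⟩
  rw [← D.encard_crossSet, ← D'.encard_crossSet]
  calc _ ≤ D'.crossSet.encard + T.encard := by gcongr
    _ = (D'.crossSet ∪ T).encard := (encard_union_eq hdisj).symm
    _ ≤ _ := encard_le_encard (union_subset hsub hTsub)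

/-- The embedding of `G □ P_d` onto the copies `s, …, s + d` of `G` in `G □ P_n`. -/
def windowHom (G : SimpleGraph V) {d n s : ℕ} (h : s + d ≤ n) : prod G d →g prod G n where
  toFun w := (w.1, ⟨s + w.2.val, by have := w.2.isLt; omega⟩)
  map_rel' := by
    intro u v huv
    rcases prod_edge_cases huv with ⟨x, y, t, hxy, rfl, rfl⟩ | ⟨x, t, t', rfl, rfl, h | h⟩
    · exact prod_adj_copy hxy _
    · exact prod_adj_link G x (by simp only; omega)
    · exact (prod_adj_link G x (by simp only; omega)).symm

theorem windowHom_injective (G : SimpleGraph V) {d n s : ℕ} (h : s + d ≤ n) :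
    Function.Injective (windowHom G h) := by
  rintro ⟨x, t⟩ ⟨y, t'⟩ hxy
  have h1 := Prod.mk.inj hxy
  have h2 := congrArg Fin.val h1.2
  simp only at h1 h2
  exact Prod.ext h1.1 (Fin.ext (by simp only; omega))

/-! ### Windows of consecutive copies -/

section Window

variable {G : SimpleGraph V} {d n s : ℕ} (h : s + d ≤ n)

theorem map_mem_copyEdges {e : Sym2 (V × Fin (d + 1))} {j : ℤ} (he : e ∈ copyEdges G d j) :
    e.map (windowHom G h) ∈ copyEdges G n (j + s) := by
  obtain ⟨u, v, huv, t, ht, rfl⟩ := he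
  exact ⟨u, v, huv, ⟨s + t.val, by have := t.isLt; omega⟩, by push_cast; omega, rfl⟩

theorem map_mem_linkEdges {e : Sym2 (V × Fin (d + 1))} {j : ℤ} (he : e ∈ linkEdges V d j) :
    e.map (windowHom G h) ∈ linkEdges V n (j + s) := by
  obtain ⟨v, t, t', ht, ht', rfl⟩ := he
  exact ⟨v, ⟨s + t.val, by have := t.isLt; omega⟩, ⟨s + t'.val, by have := t'.isLt; omega⟩,
    by push_cast; omega, by push_cast; omega, rfl⟩

theorem map_mem_crossPairs {W W' : Type*} {φ : W' → W} {E F : Set (Sym2 W')}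
    {E' F' : Set (Sym2 W)} (hE : ∀ e ∈ E, e.map φ ∈ E') (hF : ∀ e ∈ F, e.map φ ∈ F')
    {c : Sym2 (Sym2 W')} (hc : c ∈ crossPairs E F) : c.map (Sym2.map φ) ∈ crossPairs E' F' := by
  obtain ⟨e, he, f, hf, rfl⟩ := hc
  exact ⟨_, hE e he, _, hF f hf, rfl⟩

theorem map_mem_band {i : ℕ} {c : Sym2 (Sym2 (V × Fin (d + 1)))} (hc : c ∈ band G d i) :
    c.map (Sym2.map (windowHom G h)) ∈ band G n (i + s) := by
  obtain ⟨j, hj, hc⟩ := mem_iUnion₂.1 hc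
  -- Moving both edges by `s` replaces `j` by `j + s` and increases every index sum by `2 * s`, that
  -- is, the band index by `s`.
  refine mem_iUnion₂.2 ⟨j + s, ⟨by have := hj.1; omega, by have := hj.2; push_cast; omega⟩, ?_⟩
  have e1 : (2 * ((i + s : ℕ) : ℤ) - (j + s) - 1) = (2 * i - j - 1) + s := by push_cast; ring
  have e2 : (2 * ((i + s : ℕ) : ℤ) - (j + s)) = (2 * i - j) + s := by push_cast; ring
  have e3 : (2 * ((i + s : ℕ) : ℤ) - (j + s) - 2) = (2 * i - j - 2) + s := by push_cast; ring
  rw [e1, e3, e2]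
  have hboth : ∀ l : ℤ, ∀ e ∈ copyEdges G d l ∪ linkEdges V d l,
      e.map (windowHom G h) ∈ copyEdges G n (l + s) ∪ linkEdges V n (l + s) := fun l e he =>
    he.imp (map_mem_copyEdges h) (map_mem_linkEdges h)
  refine hc.imp (map_mem_crossPairs (hboth j) fun e he => ?_)
    (map_mem_crossPairs (fun e => map_mem_linkEdges h) fun e => map_mem_linkEdges h)
  exact he.imp (hboth _ e) (map_mem_copyEdges h)

end Window

/-- The sum of the positions along the path of the two ends of an edge. -/
def level {n : ℕ} : Sym2 (V × Fin (n + 1)) → ℤ :=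
  Sym2.lift ⟨fun u v => (u.2.val : ℤ) + v.2.val, fun _ _ => add_comm _ _⟩

/-- The sum of the levels of the edges of a pair. -/
def pairLevel {n : ℕ} : Sym2 (Sym2 (V × Fin (n + 1))) → ℤ :=
  Sym2.lift ⟨fun e f => level e + level f, fun _ _ => add_comm _ _⟩

/-! ### Disjointness of the bands -/

theorem level_of_mem_copyEdges {G : SimpleGraph V} {n : ℕ} {j : ℤ} {e : Sym2 (V × Fin (n + 1))}
    (he : e ∈ copyEdges G n j) : level e = 2 * j := by
  obtain ⟨u, v, -, t, ht, rfl⟩ := he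
  simp only [level, Sym2.lift_mk]
  omega

theorem level_of_mem_linkEdges {n : ℕ} {j : ℤ} {e : Sym2 (V × Fin (n + 1))}
    (he : e ∈ linkEdges V n j) : level e = 2 * j + 1 := by
  obtain ⟨v, t, t', ht, ht', rfl⟩ := he
  simp only [level, Sym2.lift_mk]
  omega

/-- Copies have even level and links odd level, and the four possible values in band `i` are
consecutive. The intervals for different `i` do not overlap, which is what makes the bands disjoint.
-/
theorem pairLevel_of_mem_band {G : SimpleGraph V} {n i : ℕ} {c : Sym2 (Sym2 (V × Fin (n + 1)))}
    (hc : c ∈ band G n i) : 4 * (i : ℤ) - 2 ≤ pairLevel c ∧ pairLevel c ≤ 4 * i + 1 := by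
  obtain ⟨j, -, hc⟩ := mem_iUnion₂.1 hc
  rcases hc with ⟨e, he, f, hf, rfl⟩ | ⟨e, he, f, hf, rfl⟩
  · have h1 : 2 * j ≤ level e ∧ level e ≤ 2 * j + 1 := by
      rcases he with he | he
      · rw [level_of_mem_copyEdges he]; omega
      · rw [level_of_mem_linkEdges he]; omega
    have h2 : level f = 2 * (2 * i - j - 1) ∨ level f = 2 * (2 * i - j - 1) + 1 ∨
        level f = 2 * (2 * i - j) := by
      rcases hf with (hf | hf) | hf
      · exact Or.inl (level_of_mem_copyEdges hf)
      · exact Or.inr (Or.inl (level_of_mem_linkEdges hf))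
      · exact Or.inr (Or.inr (level_of_mem_copyEdges hf))
    simp only [pairLevel, Sym2.lift_mk]
    omega
  · have h1 := level_of_mem_linkEdges he
    have h2 := level_of_mem_linkEdges hf
    simp only [pairLevel, Sym2.lift_mk]
    omega

theorem disjoint_band (G : SimpleGraph V) (n : ℕ) {i i' : ℕ} (h : i ≠ i') :
    Disjoint (band G n i) (band G n i') := by
  rw [disjoint_left]
  intro c hc hc'
  have h1 := pairLevel_of_mem_band hc
  have h2 := pairLevel_of_mem_band hc'
  omega

theorem sum_ncard_band_le {G : SimpleGraph V} {n N : ℕ} {C : Set (Sym2 (Sym2 (V × Fin (n + 1))))}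
    (hC : C.encard ≤ N) (J : Finset ℕ) : ∑ i ∈ J, (C ∩ band G n i).ncard ≤ N := by
  have hfin : C.Finite := finite_of_encard_le_coe hC
  have hC' : C.ncard ≤ N := by
    rw [← hfin.cast_ncard_eq] at hC; exact_mod_cast hC
  refine le_trans ?_ hC'
  have : ∑ i ∈ J, (C ∩ band G n i).ncard = (⋃ i ∈ J, C ∩ band G n i).ncard := by
    induction J using Finset.induction_on with
    | empty => simp
    | insert i J hi ih =>
      rw [Finset.sum_insert hi, ih, Finset.set_biUnion_insert, ncard_union_eq ?_
        (hfin.subset inter_subset_left)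
        (hfin.subset (iUnion₂_subset fun _ _ => inter_subset_left))]
      rw [disjoint_iUnion₂_right]
      intro i' hi'
      exact (disjoint_band G n (ne_of_mem_of_not_mem hi' hi).symm).mono inter_subset_right
        inter_subset_right
  rw [this]
  exact ncard_le_ncard (iUnion₂_subset fun _ _ => inter_subset_left) hfin

/-! ### Forces as lower bounds, and the count over all bands -/

theorem toExtInt_le {x : ℕ∞} {n : ℕ} (h : x ≤ n) : toExtInt x ≤ ((n : ℤ) : WithTop ℤ) := by
  lift x to ℕ using ne_top_of_le_ne_top (ENat.natCast_ne_top n) h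
  have h' : x ≤ n := by exact_mod_cast h
  change ((x : ℤ) : WithTop ℤ) ≤ ((n : ℤ) : WithTop ℤ)
  exact_mod_cast h'

theorem le_toExtInt {x : ℕ∞} {n : ℕ} (h : n ≤ x) : ((n : ℤ) : WithTop ℤ) ≤ toExtInt x := by
  cases x with
  | top => exact le_top
  | coe x =>
    have h' : n ≤ x := by exact_mod_cast h
    change ((n : ℤ) : WithTop ℤ) ≤ ((x : ℤ) : WithTop ℤ)
    exact_mod_cast h'

/-- A drawing of `G □ P_n` with few crossings on every copy of `G` contains, for every `s ≤ n - d`,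
a restricted drawing of `G □ P_d` whose bands are parts of the bands of the given one. -/
theorem exists_window {G : SimpleGraph V} {a d n s : ℕ} (h : s + d ≤ n)
    {D : Drawing (prod G n)} (hD : D.IsGood) (hfin : D.crossings.Finite)
    (hres : ∀ i : Fin (n + 1),
      (D.crossings ∩ crossPairs (copyEdges G n i.val) (prod G n).edgeSet).encard ≤ (a - 1 : ℕ)) :
    ∃ D' : Drawing (prod G d), D'.IsGood ∧
      (∀ R ∈ restrictedCap G a d, (D'.crossings ∩ R.1).encard ≤ (R.2 : ℕ∞)) ∧
      (∀ i, (D'.crossings ∩ band G d i).encard ≤ ((D.crossings ∩ band G n (i + s)).ncard : ℕ)) ∧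
      ∀ J : Finset ℕ, (D'.crossings ∩ bands G d J).encard ≤
        (∑ i ∈ J, (D.crossings ∩ band G n (i + s)).ncard : ℕ) := by
  have hband : ∀ i, ((D.comap (windowHom G h) (windowHom_injective G h)).crossings ∩
      band G d i).encard ≤ ((D.crossings ∩ band G n (i + s)).ncard : ℕ) := by
    intro i
    rw [(hfin.subset inter_subset_left).cast_ncard_eq]
    exact Drawing.encard_crossings_comap_le fun c => map_mem_band h
  refine ⟨D.comap (windowHom G h) (windowHom_injective G h), hD.comap _ _, ?_, hband, ?_⟩
  · rintro _ ⟨i, rfl⟩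
    refine le_trans (Drawing.encard_crossings_comap_le fun c => ?_)
      (hres ⟨i + s, by have := i.isLt; omega⟩)
    refine map_mem_crossPairs (fun e he => ?_) fun e => (windowHom G h).map_mem_edgeSet
    exact_mod_cast map_mem_copyEdges h he
  · intro J
    have : (D.comap (windowHom G h) (windowHom_injective G h)).crossings ∩ bands G d J =
        ⋃ i ∈ J, ((D.comap (windowHom G h) (windowHom_injective G h)).crossings ∩ band G d i) := by
      simp [bands, inter_iUnion]
    rw [this]
    refine (Finset.set_encard_biUnion_le _ _).trans ?_
    push_cast
    exact Finset.sum_le_sum fun i _ => hband i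

/-- Every window is a competitor in the minima that define the forces, so lower bounds on a force
carry over to the crossings of the window. -/
theorem restrictedMin_le {G : SimpleGraph V} {a d : ℕ} {D : Drawing (prod G d)} (hD : D.IsGood)
    (hres : ∀ R ∈ restrictedCap G a d, (D.crossings ∩ R.1).encard ≤ (R.2 : ℕ∞))
    {cap : Set (Set (Sym2 (Sym2 (V × Fin (d + 1)))) × ℕ)}
    (hcap : ∀ R ∈ cap, (D.crossings ∩ R.1).encard ≤ (R.2 : ℕ∞))
    (B : Set (Sym2 (Sym2 (V × Fin (d + 1))))) {x : ℕ} (hx : (D.crossings ∩ B).encard ≤ x) :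
    toExtInt (restrictedMin G a d B cap) ≤ ((x : ℤ) : WithTop ℤ) :=
  toExtInt_le <| le_trans (iInf_le _ (⟨D, hD, fun R hR => hR.elim (hres R) (hcap R)⟩ :
    {D : Drawing (prod G d) // D.IsGood ∧ ∀ R ∈ restrictedCap G a d ∪ cap,
      (D.crossings ∩ R.1).encard ≤ (R.2 : ℕ∞)})) hx

/-- The numbers of crossings in the middle and end bands compensate each other's deficits. -/
theorem le_sum_of_compensated {x : ℕ → ℤ} {a E S : ℤ} {p N : ℕ}
    (hM : ∀ j < N, a ≤ x (p + j) ∨ a - 1 ≤ x (p + j) ∧ a + 1 ≤ x (p + j + 1))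
    (hE : E ≤ S) (hE' : ∀ j, j + 1 = N → x (p + j) ≤ a - 1 → E + 1 ≤ S) (r : ℕ) :
    ∀ j, j + r = N → a * r + E ≤ ∑ i ∈ Finset.range r, x (p + j + i) + S := by
  induction r using Nat.strong_induction_on with | _ r ih => ?_
  intro j hj
  match r, ih, hj with
  | 0, _, _ => simpa using hE
  | r + 1, ih, hj =>
    rw [Finset.sum_range_succ']
    have h1 := ih r (by omega) (j + 1) (by omega)
    have e1 : ∑ i ∈ Finset.range r, x (p + (j + 1) + i) =
        ∑ i ∈ Finset.range r, x (p + j + (i + 1)) :=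
      Finset.sum_congr rfl fun i _ => by congr 1; omega
    rw [e1] at h1
    rw [add_zero]
    -- A band with at least `a` crossings stands alone. One with `a - 1` is combined with its
    -- successor, which has at least `a + 1`; the successor's own alternative is then not needed,
    -- and the induction resumes two bands later.
    rcases hM j (by omega) with h | ⟨h, h'⟩
    · push_cast
      linarith
    by_cases hxa : a ≤ x (p + j)
    · push_cast
      linarith
    match r, ih, hj with
    -- The deficient band is the last one, so the missing crossing comes from the end bands.
    | 0, _, hj =>
      have := hE' j hj (by omega)
      simp only [Finset.range_zero, Finset.sum_empty, zero_add, Nat.cast_one, mul_one]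
      linarith
    | r + 1, ih, hj =>
      rw [Finset.sum_range_succ']
      have h2 := ih r (by omega) (j + 2) (by omega)
      have e2 : ∑ i ∈ Finset.range r, x (p + (j + 2) + i) =
          ∑ i ∈ Finset.range r, x (p + j + (i + 1 + 1)) :=
        Finset.sum_congr rfl fun i _ => by congr 1; omega
      rw [e2] at h2
      rw [zero_add]
      push_cast
      linarith

/-- The lower bound for drawings in which every copy of `G` has fewer than `a` crossings. -/
theorem le_crossings_of_restricted {G : SimpleGraph V} {a : ℕ} (ha : 0 < a) {b : ℤ}
    {d m k n N : ℕ} (hmd : m < d) (hn : d + max k 1 - 1 ≤ n)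
    (hFE : (((a : ℤ) * ((d : ℤ) - 1) - b : ℤ) : WithTop ℤ) ≤ frontStar G a d m k + endStar G a d m)
    (hM : ((a : ℤ) : WithTop ℤ) ≤ middleStar G a d m)
    {D : Drawing (prod G n)} (hD : D.IsGood) (hN : D.crossings.encard ≤ N)
    (hres : ∀ i : Fin (n + 1),
      (D.crossings ∩ crossPairs (copyEdges G n i.val) (prod G n).edgeSet).encard ≤ (a - 1 : ℕ)) :
    (a : ℤ) * n - b ≤ N := by
  have hfin : D.crossings.Finite := finite_of_encard_le_coe hN
  set x : ℕ → ℕ := fun i => (D.crossings ∩ band G n i).ncard with hx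
  -- There are `n - d + 1` middle bands. This bound puts the initial run of `r + 1 ≤ k` bands, used
  -- for a front deficit, among them.
  have hk : max k 1 ≤ n - d + 1 := by omega
  have hkk : k ≤ max k 1 := le_max_left _ _
  have hdn : d ≤ n := by have := le_max_right k 1; omega
  have hmid : ∀ j < n - d + 1,
      (a : ℤ) ≤ x (m + j) ∨ (a : ℤ) - 1 ≤ x (m + j) ∧ (a : ℤ) + 1 ≤ x (m + j + 1) := by
    intro j hj
    obtain ⟨D', hD', hcap, hband, -⟩ := exists_window (s := j) (by omega : j + d ≤ n) hD hfin hres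
    by_cases hc : (D'.crossings ∩ band G d (m + 1)).encard ≤ (a : ℕ∞)
    · left
      have h1 := restrictedMin_le hD' hcap (cap := {(band G d (m + 1), a)})
        (by rintro _ rfl; exact hc) (band G d m) (hband m)
      have h2 := (hM.trans (min_le_left _ _)).trans h1
      exact_mod_cast h2
    · right
      have h1 := restrictedMin_le hD' hcap (cap := ∅) (by simp) (band G d m) (hband m)
      have h2 := (hM.trans (min_le_right _ _)).trans (add_le_add_left h1 1)
      have h3 : (a : ℤ) ≤ x (m + j) + 1 := by exact_mod_cast h2
      have h4 := (not_le.1 hc).trans_le (hband (m + 1))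
      have h5 : a < x (m + 1 + j) := by exact_mod_cast h4
      rw [show m + 1 + j = m + j + 1 by omega] at h5
      exact ⟨by omega, by omega⟩
  obtain ⟨S, hS, hES, hES'⟩ : ∃ S : ℕ, S = ∑ i ∈ Finset.Ioc m d, x (i + (n - d)) ∧
      endStar G a d m ≤ ((S : ℤ) : WithTop ℤ) ∧
      (x (m + (n - d)) ≤ a - 1 → endStar G a d m ≤ ((S - 1 : ℤ) : WithTop ℤ)) := by
    obtain ⟨D', hD', hcap, hband, hbands⟩ :=
      exists_window (s := n - d) (by omega : n - d + d ≤ n) hD hfin hres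
    have hbd := hbands (Finset.Ioc m d)
    rw [Finset.coe_Ioc] at hbd
    refine ⟨_, rfl, ?_, fun hxa => ?_⟩
    · exact (min_le_right _ _).trans (restrictedMin_le hD' hcap (by simp) _ hbd)
    · have h1 := restrictedMin_le hD' hcap (cap := {(band G d m, a - 1)})
        (by rintro _ rfl; exact (hband m).trans (by exact_mod_cast hxa)) _ hbd
      exact (min_le_left _ _).trans (add_le_add_left h1 ((-1 : ℤ) : WithTop ℤ))
  obtain ⟨T, hT, hFT⟩ : ∃ T : ℕ, T = ∑ i ∈ Finset.range m, x i ∧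
      (frontStar G a d m k ≤ ((T : ℤ) : WithTop ℤ) ∨
        frontStar G a d m k ≤ ((T + 1 : ℤ) : WithTop ℤ) ∧
          ∃ r < k, (r + 1) * a + 1 ≤ ∑ i ∈ Finset.range (r + 1), x (m + i)) := by
    obtain ⟨D', hD', hcap, hband, hbands⟩ :=
      exists_window (s := 0) (by omega : 0 + d ≤ n) hD hfin hres
    have hbd := hbands (Finset.Iio m)
    rw [Finset.coe_Iio] at hbd
    have hIio : Finset.Iio m = Finset.range m := by ext; simp
    rw [hIio] at hbd
    refine ⟨_, rfl, ?_⟩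
    by_cases hc : ∀ r < k, (D'.crossings ∩ bands G d (Icc m (m + r))).encard ≤
        ((r + 1) * a : ℕ)
    · left
      refine (min_le_left _ _).trans (restrictedMin_le hD' hcap ?_ _ hbd)
      rintro _ ⟨r, hr, rfl⟩
      exact hc r hr
    · right
      push Not at hc
      obtain ⟨r, hr, hc⟩ := hc
      have h1 := restrictedMin_le hD' hcap (cap := ∅) (by simp) _ hbd
      refine ⟨(min_le_right _ _).trans (add_le_add_left h1 1), r, hr, ?_⟩
      have h2 := hbands (Finset.Icc m (m + r))
      rw [Finset.coe_Icc] at h2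
      have h3 := hc.trans_le h2
      have h4 : (r + 1) * a < ∑ i ∈ Finset.Icc m (m + r), x i := by exact_mod_cast h3
      have h5 : ∑ i ∈ Finset.Icc m (m + r), x i = ∑ i ∈ Finset.range (r + 1), x (m + i) := by
        rw [← Finset.Ico_add_one_right_eq_Icc, Finset.sum_Ico_eq_sum_range]
        congr 2; omega
      omega
  -- The windows of `D` are admissible drawings, so the star-forces are finite and integer
  -- arithmetic applies.
  obtain ⟨E, hE⟩ := WithTop.ne_top_iff_exists.1 (ne_top_of_le_ne_top WithTop.coe_ne_top hES)
  rw [← hE] at hES hES' hFE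
  have hFtop : frontStar G a d m k ≠ ⊤ := by
    rcases hFT with h | ⟨h, -⟩ <;> exact ne_top_of_le_ne_top WithTop.coe_ne_top h
  obtain ⟨F, hF⟩ := WithTop.ne_top_iff_exists.1 hFtop
  rw [← hF] at hFT hFE
  have kFE : (a : ℤ) * ((d : ℤ) - 1) - b ≤ F + E := by exact_mod_cast hFE
  have kES : E ≤ S := by exact_mod_cast hES
  have kES' : x (m + (n - d)) ≤ a - 1 → E ≤ S - 1 := fun h => by exact_mod_cast hES' h
  have htail : ∀ r j, j + r = n - d + 1 → (a : ℤ) * r + E ≤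
      ∑ i ∈ Finset.range r, (x (m + j + i) : ℤ) + S :=
    le_sum_of_compensated (x := fun i => (x i : ℤ)) (a := a) (E := E) (S := S)
    (p := m) (N := n - d + 1) hmid kES (by
      intro j hj hxa
      have hj' : j = n - d := by omega
      subst hj'
      have hxa' : (x (m + (n - d)) : ℤ) ≤ a - 1 := hxa
      have := kES' (by omega)
      linarith)
  -- Front, middle and end together are the bands `0, …, n`, each counted once.
  have htotal : T + ∑ i ∈ Finset.range (n - d + 1), x (m + i) + S ≤ N := by
    refine le_trans (le_of_eq ?_) (sum_ncard_band_le (G := G) hN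
      (Finset.range (m + (n - d + 1) + (d - m))))
    rw [hT, hS, ← Finset.sum_range_add, Finset.sum_range_add _ (m + (n - d + 1))]
    congr 1
    rw [← Finset.Ico_add_one_add_one_eq_Ioc, Finset.sum_Ico_eq_sum_range,
      show d + 1 - (m + 1) = d - m by omega]
    exact Finset.sum_congr rfl fun i _ => by congr 1; omega
  have hnd : (n : ℤ) = d - 1 + ((n - d + 1 : ℕ) : ℤ) := by omega
  rcases hFT with h | ⟨h, r, hr, hsum⟩
  · have kF : F ≤ T := by exact_mod_cast h
    have h1 := htail (n - d + 1) 0 (by omega)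
    simp only [add_zero] at h1
    zify at htotal
    rw [hnd]
    linarith
  · have kF : F ≤ T + 1 := by exact_mod_cast h
    -- The surplus of the first `r + 1` middle bands pays for the front, and the tail estimate
    -- starts just after them. Its bound is independent of how crossings are distributed in the run,
    -- so nothing is counted twice.
    have h1 := htail (n - d - r) (r + 1) (by omega)
    rw [show n - d + 1 = (r + 1) + (n - d - r) by omega, Finset.sum_range_add] at htotal
    zify at htotal hsum
    have hr' : (n : ℤ) = d - 1 + (r + 1) + ((n - d - r : ℕ) : ℤ) := by omega
    simp only [← add_assoc] at htotal h1
    rw [hr']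
    linarith

end CartPath

end

/-! ### The induction on the length of the path -/

theorem mainTheorem2 {V : Type*} [Finite V] (G : SimpleGraph V)
    (a : ℕ) (ha : 0 < a) (b : ℤ) (d m k : ℕ)
    (hd : 2 ≤ d) (hm : 0 < m) (hmd : m < d) (hk : k ≤ d - m + 1)
    (hbase : (((a : ℤ) * ((d + max k 1 - 2 : ℕ) : ℤ) - b : ℤ) : WithTop ℤ) ≤
      CartPath.toExtInt (crossingNumber (CartPath.prod G (d + max k 1 - 2))))
    (hFE : (((a : ℤ) * ((d : ℤ) - 1) - b : ℤ) : WithTop ℤ) ≤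
      CartPath.frontStar G a d m k + CartPath.endStar G a d m)
    (hM : ((a : ℤ) : WithTop ℤ) ≤ CartPath.middleStar G a d m) :
    ∀ n : ℕ, d + max k 1 - 1 ≤ n →
      (((a : ℤ) * (n : ℤ) - b : ℤ) : WithTop ℤ) ≤
        CartPath.toExtInt (crossingNumber (CartPath.prod G n)) := by
  -- The claim is extended down by one, so that the hypothesis `hbase` becomes the base case; the
  -- restricted case then only arises for lengths at least `d + max k 1 - 1`.
  suffices h : ∀ n : ℕ, d + max k 1 - 2 ≤ n →
      (((a : ℤ) * (n : ℤ) - b : ℤ) : WithTop ℤ) ≤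
        CartPath.toExtInt (crossingNumber (CartPath.prod G n)) from
    fun n hn => h n (by omega)
  intro n hn
  induction n, hn using Nat.le_induction with
  | base => exact hbase
  | succ n hn ih =>
    by_cases htop : crossingNumber (CartPath.prod G (n + 1)) = ⊤
    · rw [htop]; exact le_top
    obtain ⟨D, hD, hDle⟩ := Drawing.exists_isGood_numCrossings_le htop
    obtain ⟨N, hN⟩ := ENat.ne_top_iff_exists.1 (ne_top_of_le_ne_top htop hDle)
    rw [← hN] at hDle
    refine le_trans ?_ (CartPath.le_toExtInt hDle)
    suffices h : (a : ℤ) * ((n + 1 : ℕ) : ℤ) - b ≤ N by exact_mod_cast h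
    -- The drawing is restricted and the bands are counted, or some copy has at least `a` crossings
    -- and is deleted. The smaller drawing need not be good, since it is only compared with the
    -- crossing number.
    by_cases hres : ∀ i : Fin (n + 1 + 1), (D.crossings ∩ CartPath.crossPairs
        (CartPath.copyEdges G (n + 1) i.val) (CartPath.prod G (n + 1)).edgeSet).encard ≤
          (a - 1 : ℕ)
    · exact CartPath.le_crossings_of_restricted ha hmd (by omega) hFE hM hD
        (D.encard_crossings_le.trans hN.ge) hres
    · push Not at hres
      obtain ⟨i, hi⟩ := hres
      obtain ⟨D', hD'⟩ := CartPath.exists_delete_layer D i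
      have h1 : (a : ℕ∞) ≤ (D.crossings ∩ CartPath.crossPairs (CartPath.copyEdges G (n + 1) i.val)
          (CartPath.prod G (n + 1)).edgeSet).encard := by
        refine le_trans (le_of_eq ?_) (Order.add_one_le_of_lt hi)
        exact_mod_cast (Nat.sub_add_cancel ha).symm
      have h2 : D'.numCrossings + a ≤ N := by
        rw [hN]; exact le_trans (by gcongr) hD'
      obtain ⟨N', hN'⟩ := ENat.ne_top_iff_exists.1
        (ne_top_of_le_ne_top (ENat.natCast_ne_top N) (le_self_add.trans h2))
      rw [← hN'] at h2
      have h3 : N' + a ≤ N := by exact_mod_cast h2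
      have h4 : crossingNumber (CartPath.prod G n) ≤ (N' : ℕ∞) := by
        rw [hN']; exact iInf_le _ D'
      have h5 := ih.trans (CartPath.toExtInt_le h4)
      have h6 : (a : ℤ) * n - b ≤ N' := by exact_mod_cast h5
      push_cast
      zify at h3
      linarith
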